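/- **Setting.** Let $\{\psi_{lk}\}$ be an $S$-regular wavelet basis of $L^2([0,1])$ ($S\ge 0$) with coarsest resolution $J_0$, of one of three types: the Haar basis ($S=J_0=0$), a periodised wavelet basis ($J_0=0$), or a boundary corrected (Cohen–Daubechies–Vial) wavelet basis ($J_0$ large enough). The scaling functions are counted as the level $l=J_0-1$; the levels $l\ge J_0$ consist of the wavelets $\psi_{lk}$, $0\le k<2^l$. Let $w=(w_l)_{l\ge J_0-1}$ be a monotone increasing sequence with $w_l\ge 1$; it is called *admissible* if $w_l/\sqrt l\uparrow\infty$ as $l\to\infty$. Let $\mathcal M_0(w)$ be the space of all sequences $x=(x_{lk})$ with $\max_k|x_{lk}|/w_l\to0$ as $l\to\infty$, normed by $\|x\|=\sup_l\max_k|x_{lk}|/w_l$. For $s\ge 0$ let $$C^s([0,1])=\Big\{f\in C([0,1]):\ \sup_{l,k}2^{l(s+1/2)}\Big|\int_0^1 f\psi_{lk}\Big|<\infty\Big\}.$$ For $X_1,X_2,\dots$ i.i.d. with law $P$ on $[0,1]$ and $j\ge J_0-1$, let $P_n(j)$ be the projected empirical measure with coefficients $\langle P_n(j),\psi_{lk}\rangle=\frac1n\sum_{i=1}^n\psi_{lk}(X_i)$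 if $l\le j$ and $0$ if $l>j$; $P$ is identified with its coefficients $\int\psi_{lk}\,dP$. The $P$-white bridge $\mathbb G_P$ is the centred Gaussian process with covariance $E[\mathbb G_P(g)\mathbb G_P(h)]=\int (g-Pg)(h-Ph)\,dP$, $g,h\in L^2(P)$, identified with the sequence $(\mathbb G_P(\psi_{lk}))_{l,k}$. **Theorem.** Let $w$ be admissible, and let $P$ have a density $f\in C^\gamma([0,1])$ for some $\gamma\ge 0$. Let $j_n$ be integers $\ge J_0-1$ such that, as $n\to\infty$, $$\frac{\sqrt n\,2^{-j_n(\gamma+1/2)}}{w_{j_n}}\to 0\qquad\text{and}\qquad \frac{2^{j_n}j_n}{n}=O(1).$$ Then $\mathbb G_P$ defines a Borel probability measure on $\mathcal M_0(w)$, the sequences $\sqrt n\,(P_n(j_n)-P)$ are $\mathcal M_0(w)$-valued random variables, and, as $n\to\infty$, $$\sqrt n\,(P_n(j_n)-P)\to^d \mathbb G_P\qquad\text{in } \mathcal M_0(w).$$ -/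

import Mathlib

open MeasureTheory ProbabilityTheory Filter Set
open scoped Topology ENNReal

noncomputable section

namespace Multiscale

/-! ### Multiscale index set and weighting sequences -/

/-- The index set `{(l, k)}` of a wavelet basis of `L²([0,1])` with coarsest resolution `J₀`:
`2 ^ J₀` scaling functions (just one if `J₀ = 0`), which form the level `J₀ - 1`, and for each
level `l ≥ J₀` the `2 ^ l` wavelets `k = 0, …, 2 ^ l - 1`. -/
inductive WIndex (J₀ : ℕ) : Type
  | scaling (k : Fin (2 ^ J₀)) : WIndex J₀
  | wavelet (l : ℕ) (hl : J₀ ≤ l) (k : Fin (2 ^ l)) : WIndex J₀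

/-- The level `l` of an index `(l, k)`; scaling functions have level `J₀ - 1`. -/
def WIndex.level {J₀ : ℕ} : WIndex J₀ → ℤ
  | .scaling _ => (J₀ : ℤ) - 1
  | .wavelet l _ _ => (l : ℤ)

/-- The translation parameter `k` of an index `(l, k)`. -/
def WIndex.shift {J₀ : ℕ} : WIndex J₀ → ℕ
  | .scaling k => k
  | .wavelet _ _ k => k

theorem WIndex.le_level {J₀ : ℕ} (i : WIndex J₀) : (J₀ : ℤ) - 1 ≤ i.level := by
  cases i with
  | scaling k => exact le_rfl
  | wavelet l hl k => simp only [WIndex.level]; omega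

instance {J₀ : ℕ} : Nonempty (WIndex J₀) := ⟨.scaling ⟨0, by positivity⟩⟩

/-- Monotone increasing weighting sequences `(w_l : l ≥ J₀ - 1)` with `w_l ≥ 1`
(values at `l < J₀ - 1` are irrelevant). -/
structure Weight (J₀ : ℕ) where
  toFun : ℤ → ℝ
  monotoneOn : MonotoneOn toFun (Ici ((J₀ : ℤ) - 1))
  one_le : ∀ l, (J₀ : ℤ) - 1 ≤ l → 1 ≤ toFun l

instance {J₀ : ℕ} : CoeFun (Weight J₀) (fun _ => ℤ → ℝ) := ⟨Weight.toFun⟩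

/-- `(w_l)` is admissible if `w_l / √l ↑ ∞` as `l → ∞` (monotonicity only for large `l`). -/
def Weight.Admissible {J₀ : ℕ} (w : Weight J₀) : Prop :=
  (∃ L : ℤ, MonotoneOn (fun l : ℤ => w l / √(l : ℝ)) (Ici L)) ∧
    Tendsto (fun l : ℤ => w l / √(l : ℝ)) atTop atTop

theorem Weight.pos {J₀ : ℕ} (w : Weight J₀) (i : WIndex J₀) : 0 < w i.level :=
  lt_of_lt_of_le one_pos (w.one_le _ i.le_level)

/-! ### The spaces `M(w)` and `M₀(w)` -/

/-- The sequences `x = (x_{lk})` with `sup_{l,k} |x_{lk}| / w_l < ∞`. -/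
def mSubmodule {J₀ : ℕ} (w : Weight J₀) : Submodule ℝ (WIndex J₀ → ℝ) where
  carrier := {x | BddAbove (range fun i => |x i| / w i.level)}
  zero_mem' := ⟨0, by rintro _ ⟨i, rfl⟩; simp⟩
  add_mem' := by
    rintro x y ⟨A, hA⟩ ⟨B, hB⟩
    refine ⟨A + B, ?_⟩
    rintro _ ⟨i, rfl⟩
    have h1 := hA (mem_range_self i)
    have h2 := hB (mem_range_self i)
    have h3 : |(x + y) i| / w i.level ≤ |x i| / w i.level + |y i| / w i.level := by
      rw [← add_div]
      exact div_le_div_of_nonneg_right (abs_add_le _ _) (w.pos i).le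
    exact h3.trans (add_le_add h1 h2)
  smul_mem' := by
    rintro c x ⟨A, hA⟩
    refine ⟨|c| * A, ?_⟩
    rintro _ ⟨i, rfl⟩
    have h1 := hA (mem_range_self i)
    have h2 : |(c • x) i| / w i.level = |c| * (|x i| / w i.level) := by
      simp [abs_mul, mul_div_assoc]
    exact h2.le.trans (mul_le_mul_of_nonneg_left h1 (abs_nonneg c))

/-- The multiscale sequence space `M(w)`. -/
def MSpace {J₀ : ℕ} (w : Weight J₀) : Type := ↥(mSubmodule w)

namespace MSpace

variable {J₀ : ℕ} {w : Weight J₀}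

instance : AddCommGroup (MSpace w) := inferInstanceAs (AddCommGroup ↥(mSubmodule w))

instance : Module ℝ (MSpace w) := inferInstanceAs (Module ℝ ↥(mSubmodule w))

/-- The `(l, k)`-th entry of a sequence in `M(w)`. -/
def coord (x : MSpace w) (i : WIndex J₀) : ℝ := x.1 i

/-- The norm `‖x‖_{M(w)} = sup_l max_k |x_{lk}| / w_l`. -/
instance : Norm (MSpace w) := ⟨fun x => ⨆ i, |x.coord i| / w i.level⟩

theorem norm_def (x : MSpace w) : ‖x‖ = ⨆ i, |x.coord i| / w i.level := rfl

theorem coord_le_norm (x : MSpace w) (i : WIndex J₀) : |x.coord i| / w i.level ≤ ‖x‖ :=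
  le_ciSup (f := fun i => |x.coord i| / w i.level) x.2 i

theorem core : NormedSpace.Core ℝ (MSpace w) where
  norm_nonneg x := Real.iSup_nonneg fun i => div_nonneg (abs_nonneg _) (w.pos i).le
  norm_smul c x := by
    have h : ∀ i, |(c • x).coord i| / w i.level = ‖c‖ * (|x.coord i| / w i.level) := fun i => by
      change |c * x.coord i| / _ = _
      rw [abs_mul, mul_div_assoc, Real.norm_eq_abs]
    simp only [norm_def, h]
    exact (Real.mul_iSup_of_nonneg (norm_nonneg c) _).symm
  norm_triangle x y := by
    rw [norm_def (x + y)]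
    refine ciSup_le fun i => ?_
    have h3 : |(x + y).coord i| / w i.level
        ≤ |x.coord i| / w i.level + |y.coord i| / w i.level := by
      rw [← add_div]
      exact div_le_div_of_nonneg_right (abs_add_le _ _) (w.pos i).le
    exact h3.trans (add_le_add (coord_le_norm x i) (coord_le_norm y i))
  norm_eq_zero_iff x := by
    constructor
    · intro h
      refine Subtype.ext (funext fun i => ?_)
      have h1 := coord_le_norm x i
      rw [h, div_le_iff₀ (w.pos i), zero_mul] at h1
      exact abs_nonpos_iff.mp h1
    · rintro rfl
      have h : ∀ i, |(0 : MSpace w).coord i| / w i.level = 0 := fun i => by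
        change |(0 : ℝ)| / _ = 0
        simp
      simp [norm_def, h]

instance : NormedAddCommGroup (MSpace w) := NormedAddCommGroup.ofCore core

instance : NormedSpace ℝ (MSpace w) := NormedSpace.ofCore core

instance : MeasurableSpace (MSpace w) := borel _

instance : BorelSpace (MSpace w) := ⟨rfl⟩

end MSpace

/-- The closed subspace `M₀(w)` of those `x ∈ M(w)` with `max_k |x_{lk}| / w_l → 0` as `l → ∞`,
with the norm and the Borel `σ`-algebra inherited from `M(w)`. -/
def M₀ {J₀ : ℕ} (w : Weight J₀) : Submodule ℝ (MSpace w) where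
  carrier := {x | Tendsto (fun i => |x.coord i| / w i.level) (comap WIndex.level atTop) (𝓝 0)}
  zero_mem' := by
    have h : ∀ i, |(0 : MSpace w).coord i| / w i.level = 0 := fun i => by
      change |(0 : ℝ)| / _ = 0
      simp
    simp only [mem_ofPred_eq, h]
    exact tendsto_const_nhds
  add_mem' := by
    intro x y hx hy
    refine squeeze_zero (fun i => div_nonneg (abs_nonneg _) (w.pos i).le) (fun i => ?_)
      (by simpa using Tendsto.add hx hy)
    rw [← add_div]
    exact div_le_div_of_nonneg_right (abs_add_le _ _) (w.pos i).le
  smul_mem' := by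
    intro c x hx
    have h : ∀ i, |(c • x).coord i| / w i.level = |c| * (|x.coord i| / w i.level) := fun i => by
      change |c * x.coord i| / _ = _
      rw [abs_mul, mul_div_assoc]
    simpa [h] using Tendsto.const_mul |c| hx

/-! ### Wavelet bases of `L²([0,1])` -/

/-- The functions `e i` form an orthonormal basis of `L²(μ)`. -/
structure IsONB {ι : Type*} (μ : Measure ℝ) (e : ι → ℝ → ℝ) : Prop where
  memLp : ∀ i, MemLp (e i) 2 μ
  norm_one : ∀ i, ∫ x, e i x * e i x ∂μ = 1
  orthogonal : ∀ i j, i ≠ j → ∫ x, e i x * e j x ∂μ = 0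
  complete : ∀ g : ℝ → ℝ, MemLp g 2 μ → (∀ i, ∫ x, g x * e i x ∂μ = 0) → g =ᵐ[μ] 0

/-- The dilated and translated function `x ↦ 2 ^ (l / 2) g (2 ^ l x - k)`. -/
def dilate (g : ℝ → ℝ) (l : ℕ) (k : ℤ) (x : ℝ) : ℝ :=
  (2 : ℝ) ^ ((l : ℝ) / 2) * g ((2 : ℝ) ^ l * x - k)

/-- The functions `φ_{J₀ k}` (scaling level) and `ψ_{lk}`, `l ≥ J₀`, before restriction to
`[0,1]`, generated from a scaling function `φ` and a wavelet `ψ`. -/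
def generated (φ ψ : ℝ → ℝ) {J₀ : ℕ} : WIndex J₀ → ℝ → ℝ
  | .scaling k => dilate φ J₀ (k : ℕ)
  | .wavelet l _ k => dilate ψ l (k : ℕ)

/-- The Haar scaling function `1_{(0,1]}`. -/
def haarScaling : ℝ → ℝ := indicator (Ioc 0 1) 1

/-- The Haar wavelet `1_{(0,1/2]} - 1_{(1/2,1]}`. -/
def haarWavelet : ℝ → ℝ := indicator (Ioc 0 (1 / 2)) 1 - indicator (Ioc (1 / 2) 1) 1

/-- All derivatives of `g` up to order `S` exist, are continuous and decay rapidly. -/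
def IsRegular (S : ℕ) (g : ℝ → ℝ) : Prop :=
  ContDiff ℝ S g ∧ ∀ r ≤ S, ∀ m : ℕ, ∃ C : ℝ, ∀ x, |iteratedDeriv r g x| ≤ C / (1 + |x|) ^ m

/-- An `S`-regular scaling function `φ` and wavelet `ψ` on `ℝ`: the functions `φ(· - k)` and
`2 ^ (l / 2) ψ(2 ^ l · - k)`, `l ≥ 0`, `k ∈ ℤ`, form an orthonormal basis of `L²(ℝ)`. -/
structure IsWaveletPair (S : ℕ) (φ ψ : ℝ → ℝ) : Prop where
  regular_scaling : IsRegular S φ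
  regular_wavelet : IsRegular S ψ
  onb : IsONB volume
    (Sum.elim (fun k : ℤ => dilate φ 0 k) (fun p : ℕ × ℤ => dilate ψ p.1 p.2))

/-- The Haar basis of `L²([0,1])` (`S = J₀ = 0`). -/
def IsHaarBasis {J₀ : ℕ} (ψ : WIndex J₀ → ℝ → ℝ) : Prop :=
  J₀ = 0 ∧ ∀ i, EqOn (ψ i) (generated haarScaling haarWavelet i) (Icc 0 1)

/-- Periodised wavelet bases (`J₀ = 0`): the functions `x ↦ ∑_{m ∈ ℤ} φ(x + m)` and
`x ↦ ∑_{m ∈ ℤ} ψ_{lk}(x + m)`, where `(φ, ψ)` is an `S`-regular pair on `ℝ`. -/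
def IsPeriodisedBasis (S : ℕ) {J₀ : ℕ} (ψ : WIndex J₀ → ℝ → ℝ) : Prop :=
  J₀ = 0 ∧ ∃ φ' ψ' : ℝ → ℝ, IsWaveletPair S φ' ψ' ∧
    ∀ i, EqOn (ψ i) (fun x => ∑' m : ℤ, generated φ' ψ' i (x + m)) (Icc 0 1)

/-- The `2 ^ l` functions at resolution `l` of a boundary corrected construction: for
`k = N, …, 2 ^ l - N - 1` the interior functions `2 ^ (l / 2) g (2 ^ l x - k)`, for the `N` first
values of `k` the left edge functions `2 ^ (l / 2) gL_k (2 ^ l x)`, and for the `N` last values of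
`k` the right edge functions `2 ^ (l / 2) gR_{k'} (2 ^ l (x - 1))`, `k' = 2 ^ l - 1 - k`. -/
def boundaryCorrected (N : ℕ) (g : ℝ → ℝ) (gL gR : ℕ → ℝ → ℝ) (l k : ℕ) (x : ℝ) : ℝ :=
  if k < N then (2 : ℝ) ^ ((l : ℝ) / 2) * gL k ((2 : ℝ) ^ l * x)
  else if k + N < 2 ^ l then dilate g l k x
  else (2 : ℝ) ^ ((l : ℝ) / 2) * gR (2 ^ l - 1 - k) ((2 : ℝ) ^ l * (x - 1))

/-- Boundary corrected wavelet bases of Cohen–Daubechies–Vial type: `(φ, ψ)` is an `S`-regular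
pair on `ℝ` supported in `[-N + 1, N]`, with `N` vanishing moments, and `2 ^ J₀ ≥ 2N`. Near
the end points of `[0,1]` the scaling functions and wavelets are replaced by dilates of `N` edge
functions, which are on the half-line finite linear combinations of the `φ(· - m)`, respectively
`φ(2 · - m)`, in such a way that one obtains an orthonormal basis of `L²([0,1])` all of
whose wavelets are orthogonal to the polynomials of degree less than `N`. -/
def IsBoundaryCorrectedBasis (S : ℕ) {J₀ : ℕ} (ψ : WIndex J₀ → ℝ → ℝ) : Prop :=
  ∃ (N : ℕ) (φ' ψ' : ℝ → ℝ) (φL φR ψL ψR : ℕ → ℝ → ℝ),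
    1 ≤ N ∧ 2 * N ≤ 2 ^ J₀ ∧ IsWaveletPair S φ' ψ' ∧
    Function.support φ' ⊆ Icc (-(N : ℝ) + 1) N ∧ Function.support ψ' ⊆ Icc (-(N : ℝ) + 1) N ∧
    (∀ p < N, ∫ x, x ^ p * ψ' x = 0) ∧
    (∀ k < N, ∃ g ∈ Submodule.span ℝ (range fun (m : ℤ) (x : ℝ) => φ' (x - m)),
      EqOn (φL k) g (Ici 0)) ∧
    (∀ k < N, ∃ g ∈ Submodule.span ℝ (range fun (m : ℤ) (x : ℝ) => φ' (x - m)),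
      EqOn (φR k) g (Iic 0)) ∧
    (∀ k < N, ∃ g ∈ Submodule.span ℝ (range fun (m : ℤ) (x : ℝ) => φ' (2 * x - m)),
      EqOn (ψL k) g (Ici 0)) ∧
    (∀ k < N, ∃ g ∈ Submodule.span ℝ (range fun (m : ℤ) (x : ℝ) => φ' (2 * x - m)),
      EqOn (ψR k) g (Iic 0)) ∧
    (∀ k, EqOn (ψ (.scaling k)) (boundaryCorrected N φ' φL φR J₀ k) (Icc 0 1)) ∧
    (∀ l hl k, EqOn (ψ (.wavelet l hl k)) (boundaryCorrected N ψ' ψL ψR l k) (Icc 0 1)) ∧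
    (∀ l hl k, ∀ p < N, ∫ x in Icc (0 : ℝ) 1, x ^ p * ψ (.wavelet l hl k) x = 0) ∧
    IsONB (volume.restrict (Icc (0 : ℝ) 1)) ψ

/-- The wavelet bases `{ψ_{lk}}` of `L²([0,1])` under consideration: the Haar basis, `S`-regular
periodised bases and `S`-regular boundary corrected bases. Only the values on `[0,1]` matter. -/
def IsWaveletBasis (S : ℕ) {J₀ : ℕ} (ψ : WIndex J₀ → ℝ → ℝ) : Prop :=
  (S = 0 ∧ IsHaarBasis ψ) ∨ IsPeriodisedBasis S ψ ∨ IsBoundaryCorrectedBasis S ψ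

/-! ### Hölder-type spaces, empirical wavelet coefficients, the white bridge -/

/-- `f ∈ C^s([0,1])`: `f` is continuous on `[0,1]` and
`sup_{l,k} 2 ^ {l(s + 1/2)} |⟨ψ_{lk}, f⟩| < ∞`. -/
def MemHolderSpace {J₀ : ℕ} (ψ : WIndex J₀ → ℝ → ℝ) (s : ℝ) (f : ℝ → ℝ) : Prop :=
  ContinuousOn f (Icc 0 1) ∧
    BddAbove (range fun i : WIndex J₀ =>
      (2 : ℝ) ^ ((i.level : ℝ) * (s + 1 / 2)) * |∫ x in Icc (0 : ℝ) 1, ψ i x * f x|)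

/-- `P` is a probability measure on `[0,1]` with Lebesgue density `f`. -/
structure HasDensity (P : Measure ℝ) (f : ℝ → ℝ) : Prop where
  isProbabilityMeasure : IsProbabilityMeasure P
  nonneg : ∀ x ∈ Icc (0 : ℝ) 1, 0 ≤ f x
  eq_withDensity : P = (volume.restrict (Icc 0 1)).withDensity fun x => ENNReal.ofReal (f x)

/-- The coefficients `⟨P_n(j), ψ_{lk}⟩` of the projected empirical measure of `X_0, …, X_{n-1}`:
`n⁻¹ ∑_{m < n} ψ_{lk}(X_m)` if `l ≤ j`, and `0` if `l > j`. -/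
def empiricalCoeff {Ω : Type*} {J₀ : ℕ} (ψ : WIndex J₀ → ℝ → ℝ) (X : ℕ → Ω → ℝ) (n : ℕ) (j : ℤ)
    (ω : Ω) (i : WIndex J₀) : ℝ :=
  if i.level ≤ j then (n : ℝ)⁻¹ * ∑ m ∈ Finset.range n, ψ i (X m ω) else 0

/-- `(Z t)` is a version of the `P`-white bridge process `𝔾_P` along the family `(g t)` of
functions in `L²(P)`: a centred Gaussian process with covariance
`E[𝔾_P(g) 𝔾_P(h)] = ∫ (g - Pg)(h - Ph) dP`. -/
structure IsWhiteBridge {Ω T : Type*} [MeasurableSpace Ω] (P : Measure ℝ) (g : T → ℝ → ℝ)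
    (Z : T → Ω → ℝ) (μ : Measure Ω) : Prop where
  memLp : ∀ t, MemLp (g t) 2 P
  gaussian : IsGaussianProcess Z μ
  mean_zero : ∀ t, ∫ ω, Z t ω ∂μ = 0
  covariance : ∀ s t, ∫ ω, Z s ω * Z t ω ∂μ =
    ∫ x, (g s x - ∫ y, g s y ∂P) * (g t x - ∫ y, g t y ∂P) ∂P

end Multiscale

end

open Multiscale

/-!
The space `M₀(w)` is a weighted `c₀`: since there are finitely many indices at each level, its
elements are the families with `x_i / w_i → 0` along the cofinite filter. Hence truncations
converge in norm, so that a finite measure on `M₀(w)` is determined by its finite-dimensional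
marginals (`M₀.measure_ext`), and a box `|x_i| ≤ b_i` with `b_i / w_i → 0` is compact
(`M₀.isCompact_box`). The limit theorem then follows from Prokhorov's theorem: the laws of
`√n (P_n(j_n) - P)` are tight, and all their cluster points have the same marginals. In
particular the law of the white bridge on `M₀(w)` is obtained as the limit, and need not be
constructed separately.

*Marginals.* The resolution levels `j_n` tend to infinity by the bias condition, so a fixed finite
linear combination of coefficients is eventually a normalised sum of i.i.d. variables, and the
one-dimensional central limit theorem applies (`tendsto_map_combination`). By the Cramér–Wold
device this determines the marginals (`IsBridgeLaw.unique`), and Gaussianity and the covariance of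
the limit are read off from its linear functionals (`IsBridgeLaw.isWhiteBridge`).

*Tightness.* Above level `j_n` the coefficients are deterministic and tend to zero in `M₀(w)`,
by the Hölder bound for `f` and the bias condition. At a level `l ≤ j_n` the summands are bounded
by a multiple of `2 ^ (l / 2)` and have bounded variance, because
`|ψ_{lk}| ≤ C 2 ^ (l / 2)`, `‖ψ_{lk}‖₂ ≤ C` (`IsWaveletBasis.exists_waveletBounds`) and `f` is
bounded. As `l 2 ^ l ≤ j_n 2 ^ {j_n} = O(n)`, the Chernoff bound may be used with a parameter of
order `√l`, and shows that a coefficient exceeds `M √l` with probability at most a small multiple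
of `e ^ {-3 l}`, which is summable over the `2 ^ l` coefficients at level `l` and then over `l`.
The resulting thresholds are `o(w_l)` because `w` is admissible (`exists_thresholds`), so with
high probability the levels up to `j_n` stay in a fixed compact box.
-/

noncomputable section

namespace Multiscale

/-! ### The index set -/

namespace WIndex

variable {J₀ : ℕ}

theorem level_add_one_nonneg (i : WIndex J₀) : 0 ≤ i.level + 1 := by
  have := i.le_level
  omega

theorem shift_lt (i : WIndex J₀) : i.shift < 2 ^ (i.level + 1).toNat := by
  cases i with
  | scaling k => simp [shift, level]
  | wavelet l hl k =>
    refine k.2.trans_le ?_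
    simp only [level]
    exact Nat.pow_le_pow_right two_pos (by omega)

/-- The level is shifted by one since that of the scaling functions may be `-1`. -/
theorem injective_level_shift :
    Function.Injective fun i : WIndex J₀ => ((i.level + 1).toNat, i.shift) := by
  intro i i' h
  simp only [Prod.mk.injEq] at h
  obtain ⟨h1, h2⟩ := h
  cases i with
  | scaling k =>
    cases i' with
    | scaling k' => simpa [shift, Fin.ext_iff] using h2
    | wavelet l' hl' k' => simp only [level] at h1; omega
  | wavelet l hl k =>
    cases i' with
    | scaling k' => simp only [level] at h1; omega
    | wavelet l' hl' k' =>
      have : l = l' := by simp only [level] at h1; omega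
      subst this
      simpa [shift, Fin.ext_iff] using h2

instance : Countable (WIndex J₀) := injective_level_shift.countable

theorem finite_level_le (L : ℤ) : {i : WIndex J₀ | i.level ≤ L}.Finite := by
  refine Set.Finite.of_finite_image (f := fun i => ((i.level + 1).toNat, i.shift)) ?_
    injective_level_shift.injOn
  refine ((finite_Iic (L + 1).toNat).prod (finite_Iic (2 ^ (L + 1).toNat))).subset ?_
  rintro _ ⟨i, hi, rfl⟩
  have hi : i.level ≤ L := hi
  have h : (i.level + 1).toNat ≤ (L + 1).toNat := by omega
  exact ⟨h, i.shift_lt.le.trans (Nat.pow_le_pow_right two_pos h)⟩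

/-- As there are finitely many indices at each level, letting the level tend to infinity is
letting the index leave the finite sets. -/
theorem comap_level_atTop : comap (level (J₀ := J₀)) atTop = cofinite := by
  apply le_antisymm
  · rw [le_cofinite_iff_compl_singleton_mem]
    intro i
    exact ⟨Ioi i.level, Ioi_mem_atTop _, fun i' hi' h => by
      rw [mem_singleton_iff.1 h] at hi'; exact lt_irrefl i.level hi'⟩
  · rw [← tendsto_iff_comap, tendsto_atTop]
    intro L
    rw [eventually_cofinite]
    exact (finite_level_le L).subset fun i hi => (not_le.1 hi).le

theorem tendsto_level : Tendsto (level (J₀ := J₀)) cofinite atTop :=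
  tendsto_iff_comap.2 comap_level_atTop.ge

theorem summable_exp_level : Summable fun i : WIndex J₀ => Real.exp (-3 * i.level) := by
  have h1 : Summable fun p : ℕ × ℕ => (1 / 2 : ℝ) ^ p.1 * (1 / ((p.2 : ℝ) + 1) ^ 2) := by
    have h2 : Summable fun k : ℕ => 1 / ((k : ℝ) + 1) ^ 2 := by
      exact_mod_cast (summable_nat_add_iff 1).2 (Real.summable_one_div_nat_pow.2 one_lt_two)
    exact summable_geometric_two.mul_of_nonneg h2 (fun _ => by positivity)
      (fun _ => by positivity)
  refine Summable.of_nonneg_of_le (fun _ => (Real.exp_pos _).le) (fun i => ?_)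
    ((h1.comp_injective injective_level_shift).mul_left (Real.exp 3))
  simp only [Function.comp_apply]
  have h3 : ((i.level + 1).toNat : ℝ) = i.level + 1 := by
    exact_mod_cast Int.toNat_of_nonneg i.level_add_one_nonneg
  have h4 : ((i.shift : ℝ) + 1) ≤ 2 ^ (i.level + 1).toNat := by exact_mod_cast i.shift_lt
  set a := (i.level + 1).toNat
  have h5 : Real.exp (-1) ≤ 1 / 2 := by
    rw [Real.exp_neg, one_div]
    gcongr
    have := Real.add_one_le_exp 1
    linarith
  have h6 : Real.exp (-3 * i.level) = Real.exp 3 * (Real.exp (-1) ^ a) ^ 3 := by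
    rw [← Real.exp_nat_mul, ← Real.exp_nat_mul, ← Real.exp_add, h3]
    congr 1; push_cast; ring
  rw [h6]
  gcongr
  calc (Real.exp (-1) ^ a) ^ 3 ≤ ((1 / 2) ^ a) ^ 3 := by gcongr
    _ = (1 / 2) ^ a * (1 / (2 ^ a) ^ 2) := by
      simp only [one_div, inv_pow]; ring
    _ ≤ _ := by gcongr

end WIndex

/-! ### The space `M₀(w)` as a weighted `c₀` -/

namespace M₀

variable {J₀ : ℕ} {w : Weight J₀}

/-- The `i`-th entry of a sequence in `M₀(w)`. -/
def entry (x : M₀ w) (i : WIndex J₀) : ℝ := (x : MSpace w).coord i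

theorem ext {x y : M₀ w} (h : ∀ i, entry x i = entry y i) : x = y :=
  Subtype.ext (Subtype.ext (funext h))

theorem abs_entry_le (x : M₀ w) (i : WIndex J₀) : |entry x i| ≤ w i.level * ‖x‖ := by
  have := (div_le_iff₀ (w.pos i)).1 (MSpace.coord_le_norm (x : MSpace w) i)
  rw [mul_comm]
  exact this

theorem norm_le {x : M₀ w} {a : ℝ} (h : ∀ i, |entry x i| ≤ a * w i.level) : ‖x‖ ≤ a :=
  ciSup_le fun i => (div_le_iff₀ (w.pos i)).2 (h i)

theorem tendsto_entry (x : M₀ w) :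
    Tendsto (fun i => |entry x i| / w i.level) cofinite (𝓝 0) := by
  rw [← WIndex.comap_level_atTop]
  exact x.2

/-- The element of `M₀(w)` with given entries, which must be `o(w)` along the cofinite filter. -/
def mk (x : WIndex J₀ → ℝ) (h : Tendsto (fun i => |x i| / w i.level) cofinite (𝓝 0)) : M₀ w :=
  ⟨⟨x, h.bddAbove_range_of_cofinite⟩, by
    rw [← WIndex.comap_level_atTop] at h
    exact h⟩

@[simp]
theorem entry_mk (x : WIndex J₀ → ℝ) (h) : entry (mk (w := w) x h) = x := rfl

/-- The entries as continuous linear functionals on `M₀(w)`. -/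
def entryL (i : WIndex J₀) : M₀ w →L[ℝ] ℝ :=
  LinearMap.mkContinuous
    { toFun := fun x => entry x i
      map_add' := fun _ _ => rfl
      map_smul' := fun _ _ => rfl } (w i.level) fun x => abs_entry_le x i

@[simp]
theorem entry_add (x y : M₀ w) (i : WIndex J₀) : entry (x + y) i = entry x i + entry y i := rfl

@[simp]
theorem entry_sub (x y : M₀ w) (i : WIndex J₀) : entry (x - y) i = entry x i - entry y i := rfl

@[fun_prop]
theorem continuous_entry (i : WIndex J₀) : Continuous fun x : M₀ w => entry x i :=
  (entryL i).continuous

@[fun_prop]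
theorem measurable_entry (i : WIndex J₀) : Measurable fun x : M₀ w => entry x i :=
  (continuous_entry i).measurable

open scoped Classical in
theorem tendsto_extend (I : Finset (WIndex J₀)) (y : I → ℝ) :
    Tendsto (fun i => |if h : i ∈ I then y ⟨i, h⟩ else 0| / w i.level) cofinite (𝓝 0) := by
  refine tendsto_const_nhds.congr' ?_
  filter_upwards [I.finite_toSet.compl_mem_cofinite] with i hi
  have : i ∉ I := hi
  simp [this]

open scoped Classical in
/-- Extension by zero of a finite family of entries. -/
def extend (I : Finset (WIndex J₀)) : (I → ℝ) →L[ℝ] M₀ w :=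
  LinearMap.toContinuousLinearMap
    { toFun := fun y => mk (fun i => if h : i ∈ I then y ⟨i, h⟩ else 0) (tendsto_extend I y)
      map_add' := fun y z => ext fun i => by
        rw [entry_add]
        simp only [entry_mk, Pi.add_apply]
        split_ifs <;> simp
      map_smul' := fun c y => ext fun i => by
        change _ = c * entry (mk _ _) i
        simp only [entry_mk, Pi.smul_apply, smul_eq_mul]
        split_ifs <;> simp }

theorem entry_extend_of_mem {I : Finset (WIndex J₀)} (y : I → ℝ) {i : WIndex J₀} (h : i ∈ I) :
    entry (extend (w := w) I y) i = y ⟨i, h⟩ := by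
  classical
  change dite _ _ _ = _
  rw [dif_pos h]

theorem entry_extend_of_notMem {I : Finset (WIndex J₀)} (y : I → ℝ) {i : WIndex J₀} (h : i ∉ I) :
    entry (extend (w := w) I y) i = 0 := by
  classical
  change dite _ _ _ = _
  rw [dif_neg h]

/-- Truncations converge in norm; this is where `M₀(w)` is better than `M(w)`. -/
theorem tendsto_extend_restrict (x : M₀ w) :
    Tendsto (fun I : Finset (WIndex J₀) => extend (w := w) I fun i => entry x i) atTop (𝓝 x) := by
  rw [Metric.tendsto_nhds]
  intro ε hε
  have h := ((tendsto_entry x).eventually_lt_const (half_pos hε))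
  rw [eventually_cofinite] at h
  filter_upwards [eventually_ge_atTop h.toFinset] with I hI
  rw [dist_eq_norm]
  refine (norm_le (a := ε / 2) fun i => ?_).trans_lt (half_lt_self hε)
  by_cases hi : i ∈ I
  · rw [entry_sub, entry_extend_of_mem _ hi, sub_self, abs_zero]
    exact mul_nonneg (half_pos hε).le (w.pos i).le
  · rw [entry_sub, entry_extend_of_notMem _ hi, zero_sub, abs_neg]
    have : i ∉ h.toFinset := fun h' => hi (hI h')
    simp only [Finite.mem_toFinset, mem_ofPred_eq, not_not] at this
    exact ((div_lt_iff₀ (w.pos i)).1 this).le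

/-- A finite measure on `M₀(w)` is determined by its finite-dimensional marginals. -/
theorem measure_ext {ν ν' : Measure (M₀ w)} [IsFiniteMeasure ν] [IsFiniteMeasure ν']
    (h : ∀ I : Finset (WIndex J₀), ν.map (fun x (i : I) => entry x i.1)
      = ν'.map (fun x (i : I) => entry x i.1)) : ν = ν' := by
  refine ext_of_forall_integral_eq_of_IsFiniteMeasure fun g => ?_
  have key : ∀ (ρ : Measure (M₀ w)) [IsFiniteMeasure ρ],
      Tendsto (fun I : Finset (WIndex J₀) =>
        ∫ y, g (extend I y) ∂(ρ.map (fun x (i : I) => entry x i.1))) atTop (𝓝 (∫ x, g x ∂ρ)) := by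
    intro ρ _
    have h1 : ∀ I : Finset (WIndex J₀),
        ∫ y, g (extend I y) ∂(ρ.map (fun x (i : I) => entry x i.1))
          = ∫ x, g (extend I fun i => entry x i) ∂ρ := fun I =>
      integral_map (by fun_prop)
        (g.continuous.comp (extend I).continuous).stronglyMeasurable.aestronglyMeasurable
    simp only [h1]
    refine tendsto_integral_filter_of_dominated_convergence (fun _ => ‖g‖) ?_ ?_
      (integrable_const _) ?_
    · refine Eventually.of_forall fun I => ?_
      have : Continuous fun x : M₀ w => g (extend I fun i => entry x i) :=
        g.continuous.comp ((extend I).continuous.comp (by fun_prop))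
      exact (this.measurable).aestronglyMeasurable
    · exact Eventually.of_forall fun I => Eventually.of_forall fun x => g.norm_coe_le_norm _
    · exact Eventually.of_forall fun x =>
        (g.continuous.tendsto x).comp (tendsto_extend_restrict x)
  exact tendsto_nhds_unique (key ν) (by simpa only [h] using key ν')

/-- The box `|x_i| ≤ b_i` is compact in `M₀(w)` if `b_i / w_i → 0`: it is a continuous image of
a product of compact intervals, as the tails of its elements are uniformly small. -/
theorem isCompact_box {b : WIndex J₀ → ℝ}
    (hb : Tendsto (fun i => b i / w i.level) cofinite (𝓝 0)) :
    IsCompact {x : M₀ w | ∀ i, |entry x i| ≤ b i} := by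
  have hmem : ∀ y : (i : WIndex J₀) → Icc (-b i) (b i),
      Tendsto (fun i => |(y i : ℝ)| / w i.level) cofinite (𝓝 0) := fun y =>
    squeeze_zero (fun i => div_nonneg (abs_nonneg _) (w.pos i).le)
      (fun i => div_le_div_of_nonneg_right (abs_le.2 (y i).2) (w.pos i).le) hb
  let T : ((i : WIndex J₀) → Icc (-b i) (b i)) → M₀ w := fun y => mk (fun i => y i) (hmem y)
  have hT : Continuous T := by
    refine continuous_iff_continuousAt.2 fun y => ?_
    rw [ContinuousAt, Metric.tendsto_nhds]
    intro ε hε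
    have h := hb.eventually_lt_const (show 0 < ε / 4 by positivity)
    rw [eventually_cofinite] at h
    have h1 : ∀ i ∈ {i | ¬b i / w i.level < ε / 4},
        ∀ᶠ z in 𝓝 y, |((z i : ℝ)) - y i| < ε / 2 * w i.level := fun i _ => by
      have hc : Continuous fun z : (i : WIndex J₀) → Icc (-b i) (b i) =>
          |((z i : ℝ)) - y i| := by fun_prop
      refine hc.continuousAt.eventually_lt continuousAt_const ?_
      rw [sub_self, abs_zero]
      exact mul_pos (half_pos hε) (w.pos i)
    filter_upwards [(eventually_all_finite h).2 h1] with z hz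
    rw [dist_eq_norm]
    refine (norm_le (a := ε / 2) fun i => ?_).trans_lt (half_lt_self hε)
    change |(z i : ℝ) - y i| ≤ _
    by_cases hi : b i / w i.level < ε / 4
    · rw [div_lt_iff₀ (w.pos i)] at hi
      have h2 := abs_sub (z i : ℝ) (y i)
      have h3 := abs_le.2 (z i).2
      have h4 := abs_le.2 (y i).2
      linarith
    · exact (hz i hi).le
  have himage : {x : M₀ w | ∀ i, |entry x i| ≤ b i} = range T := by
    ext x
    constructor
    · intro hx
      exact ⟨fun i => ⟨entry x i, abs_le.1 (hx i)⟩, ext fun i => rfl⟩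
    · rintro ⟨y, rfl⟩ i
      exact abs_le.2 (y i).2
  rw [himage]
  exact isCompact_range hT

end M₀

/-! ### An exponential inequality for sums of bounded variables -/

section Chernoff

variable {Ω : Type*} [MeasurableSpace Ω] {μ : Measure Ω} [IsProbabilityMeasure μ]

theorem integrable_exp_mul_of_bounded {Y : Ω → ℝ} (hY : AEMeasurable Y μ) {B : ℝ}
    (hB : ∀ᵐ ω ∂μ, |Y ω| ≤ B) (s : ℝ) : Integrable (fun ω => Real.exp (s * Y ω)) μ := by
  refine Integrable.of_bound (Real.measurable_exp.comp_aemeasurable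
    (hY.const_mul s)).aestronglyMeasurable (Real.exp (|s| * B)) ?_
  filter_upwards [hB] with ω hω
  rw [Real.norm_eq_abs, Real.abs_exp, Real.exp_le_exp]
  calc s * Y ω ≤ |s * Y ω| := le_abs_self _
    _ = |s| * |Y ω| := abs_mul _ _
    _ ≤ _ := by gcongr

/-- A consequence of `exp x ≤ 1 + x + x ^ 2` for `|x| ≤ 1`. -/
theorem mgf_le_exp_of_bounded {Y : Ω → ℝ} (hY : AEMeasurable Y μ) {B v s : ℝ}
    (hB : ∀ᵐ ω ∂μ, |Y ω| ≤ B) (h0 : ∫ ω, Y ω ∂μ = 0) (hv : ∫ ω, Y ω ^ 2 ∂μ ≤ v)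
    (hs : |s| * B ≤ 1) : mgf Y μ s ≤ Real.exp (s ^ 2 * v) := by
  have hint : Integrable Y μ := Integrable.of_bound hY.aestronglyMeasurable B hB
  have hint2 : Integrable (fun ω => Y ω ^ 2) μ := by
    refine Integrable.of_bound (hY.pow_const 2).aestronglyMeasurable (B ^ 2) ?_
    filter_upwards [hB] with ω hω
    rw [Real.norm_eq_abs, abs_pow]
    gcongr
  have hint1 : Integrable (fun ω => 1 + s * Y ω) μ := (integrable_const 1).add (hint.const_mul s)
  calc mgf Y μ s ≤ ∫ ω, (1 + s * Y ω + s ^ 2 * Y ω ^ 2) ∂μ := by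
        refine integral_mono_ae (integrable_exp_mul_of_bounded hY hB s)
          (hint1.add (hint2.const_mul _)) ?_
        filter_upwards [hB] with ω hω
        have h1 : |s * Y ω| ≤ 1 := by
          rw [abs_mul]
          exact (mul_le_mul_of_nonneg_left hω (abs_nonneg s)).trans hs
        have h2 := (abs_le.1 (Real.abs_exp_sub_one_sub_id_le h1)).2
        nlinarith
    _ = 1 + s ^ 2 * ∫ ω, Y ω ^ 2 ∂μ := by
        rw [integral_add hint1 (hint2.const_mul _),
          integral_add (integrable_const _) (hint.const_mul s), integral_const_mul,
          integral_const_mul, h0]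
        simp
    _ ≤ 1 + s ^ 2 * v := by gcongr
    _ ≤ _ := by linarith [Real.add_one_le_exp (s ^ 2 * v)]

theorem measureReal_le_sum_le {Y : ℕ → Ω → ℝ} (hY : ∀ m, AEMeasurable (Y m) μ)
    (hindep : iIndepFun Y μ) {B v s : ℝ} (hB : ∀ m, ∀ᵐ ω ∂μ, |Y m ω| ≤ B)
    (h0 : ∀ m, ∫ ω, Y m ω ∂μ = 0) (hv : ∀ m, ∫ ω, Y m ω ^ 2 ∂μ ≤ v)
    (hs0 : 0 ≤ s) (hs : s * B ≤ 1) (n : ℕ) (t : ℝ) :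
    μ.real {ω | t ≤ ∑ m ∈ Finset.range n, Y m ω} ≤ Real.exp (-s * t + n * (s ^ 2 * v)) := by
  have hbd : ∀ᵐ ω ∂μ, |(∑ m ∈ Finset.range n, Y m) ω| ≤ n * B := by
    filter_upwards [ae_all_iff.2 hB] with ω hω
    rw [Finset.sum_apply]
    refine (Finset.abs_sum_le_sum_abs _ _).trans ?_
    refine (Finset.sum_le_card_nsmul _ _ B fun m _ => hω m).trans ?_
    simp
  have hmeas : AEMeasurable (∑ m ∈ Finset.range n, Y m) μ :=
    Finset.aemeasurable_sum _ fun m _ => hY m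
  have h1 := measure_ge_le_exp_mul_mgf t hs0 (integrable_exp_mul_of_bounded hmeas hbd s)
  simp only [Finset.sum_apply] at h1
  refine h1.trans ?_
  rw [Real.exp_add, hindep.mgf_sum₀ hY]
  gcongr
  calc ∏ m ∈ Finset.range n, mgf (Y m) μ s
      ≤ ∏ _m ∈ Finset.range n, Real.exp (s ^ 2 * v) := by
        refine Finset.prod_le_prod (fun _ _ => mgf_nonneg) fun m _ => ?_
        exact mgf_le_exp_of_bounded (hY m) (hB m) (h0 m) (hv m) (by rwa [abs_of_nonneg hs0])
    _ = Real.exp (n * (s ^ 2 * v)) := by simp [Real.exp_nat_mul]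

/-- A Bernstein-type inequality for sums of independent, centred, bounded variables, with the free
parameter `s` of the Chernoff bound restricted to the range where the cumulant generating
function is quadratic. -/
theorem measureReal_le_abs_sum_le {Y : ℕ → Ω → ℝ} (hY : ∀ m, AEMeasurable (Y m) μ)
    (hindep : iIndepFun Y μ) {B v s : ℝ} (hB : ∀ m, ∀ᵐ ω ∂μ, |Y m ω| ≤ B)
    (h0 : ∀ m, ∫ ω, Y m ω ∂μ = 0) (hv : ∀ m, ∫ ω, Y m ω ^ 2 ∂μ ≤ v)
    (hs0 : 0 ≤ s) (hs : s * B ≤ 1) (n : ℕ) (t : ℝ) :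
    μ.real {ω | t ≤ |∑ m ∈ Finset.range n, Y m ω|}
      ≤ 2 * Real.exp (-s * t + n * (s ^ 2 * v)) := by
  have h1 := measureReal_le_sum_le hY hindep hB h0 hv hs0 hs n t
  have h2 := measureReal_le_sum_le (Y := fun m ω => -Y m ω) (fun m => (hY m).neg)
    (hindep.comp (fun _ x => -x) fun _ => measurable_neg) (B := B) (v := v) (by simpa using hB)
    (fun m => by rw [integral_neg, h0 m, neg_zero]) (by simpa using hv) hs0 hs n t
  have h3 : {ω | t ≤ |∑ m ∈ Finset.range n, Y m ω|} ⊆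
      {ω | t ≤ ∑ m ∈ Finset.range n, Y m ω} ∪ {ω | t ≤ ∑ m ∈ Finset.range n, -Y m ω} := by
    intro ω (hω : t ≤ |∑ m ∈ Finset.range n, Y m ω|)
    simpa [Finset.sum_neg_distrib] using le_abs.1 hω
  linarith [(measureReal_mono h3 (measure_ne_top μ _)).trans (measureReal_union_le _ _)]

end Chernoff

/-! ### Size of the wavelets -/

/-- The sum is periodic in `a`, so that it suffices to treat the fractional
part of `a`, for which there is a summable majorant independent of `a`. -/
theorem exists_tsum_shift_le : ∃ Q : ℝ, ∀ a : ℝ,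
    Summable (fun m : ℤ => 1 / (1 + |a + m|) ^ 2) ∧ ∑' m : ℤ, 1 / (1 + |a + m|) ^ 2 ≤ Q := by
  have hs : Summable fun m : ℤ => 4 * (1 / |(m : ℝ) + 1 / 2| ^ (2 : ℝ)) :=
    ((Real.summable_one_div_int_add_rpow (1 / 2) 2).2 one_lt_two).mul_left 4
  have hle : ∀ a : ℝ, ∀ m : ℤ, 1 / (1 + |Int.fract a + m|) ^ 2
      ≤ 4 * (1 / |(m : ℝ) + 1 / 2| ^ (2 : ℝ)) := by
    intro a m
    have hpos : 0 < |(m : ℝ) + 1 / 2| := by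
      rw [abs_pos]
      intro h
      have : (2 * m + 1 : ℝ) = 0 := by linarith
      have : (2 * m + 1 : ℤ) = 0 := by exact_mod_cast this
      omega
    have h1 : |(m : ℝ) + 1 / 2| ≤ 2 * (1 + |Int.fract a + m|) := by
      have h0 := Int.fract_nonneg a
      have h1 := (Int.fract_lt_one a).le
      have h2 := abs_nonneg (Int.fract a + m)
      have h3 := abs_le.1 (le_refl |Int.fract a + m|)
      exact abs_le.2 ⟨by linarith, by linarith⟩
    rw [Real.rpow_two, mul_one_div, div_le_div_iff₀ (by positivity) (by positivity)]
    nlinarith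
  refine ⟨∑' m : ℤ, 4 * (1 / |(m : ℝ) + 1 / 2| ^ (2 : ℝ)), fun a => ?_⟩
  have h1 : Summable fun m : ℤ => 1 / (1 + |Int.fract a + m|) ^ 2 :=
    Summable.of_nonneg_of_le (fun _ => by positivity) (hle a) hs
  have h2 : (fun m : ℤ => 1 / (1 + |a + m|) ^ 2)
      = (fun m : ℤ => 1 / (1 + |Int.fract a + m|) ^ 2) ∘ Equiv.addRight ⌊a⌋ := by
    funext m
    have : Int.fract a + ((m : ℝ) + ⌊a⌋) = a + m := by
      rw [Int.fract]; ring
    simp [this]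
  rw [h2]
  refine ⟨(Equiv.summable_iff _).2 h1, ?_⟩
  refine ((Equiv.addRight ⌊a⌋).tsum_eq fun m : ℤ => 1 / (1 + |Int.fract a + m|) ^ 2).le.trans ?_
  exact h1.tsum_le_tsum (hle a) hs

theorem integrable_of_decay {g : ℝ → ℝ} (hg : Measurable g) {K : ℝ}
    (hK : ∀ x, |g x| ≤ K / (1 + |x|) ^ 2) : Integrable g := by
  have h := (integrable_one_add_norm (E := ℝ) (μ := volume) (r := 2) (by simp)).const_mul K
  refine h.mono' hg.aestronglyMeasurable (Eventually.of_forall fun x => ?_)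
  rw [Real.norm_eq_abs, Real.norm_eq_abs, Real.rpow_neg (by positivity), Real.rpow_two,
    ← div_eq_mul_inv]
  exact hK x

theorem measurable_dilate {g : ℝ → ℝ} (hg : Measurable g) (l : ℕ) (k : ℤ) :
    Measurable (dilate g l k) :=
  (hg.comp ((measurable_id.const_mul _).sub_const _)).const_mul _

theorem integrable_dilate {g : ℝ → ℝ} (hg : Integrable g) (l : ℕ) (k : ℤ) :
    Integrable (dilate g l k) :=
  ((hg.comp_sub_right (k : ℝ)).comp_mul_left' (by positivity)).const_mul _

theorem integral_abs_dilate (g : ℝ → ℝ) (l : ℕ) (k : ℤ) :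
    (2 : ℝ) ^ ((l : ℝ) / 2) * ∫ x, |dilate g l k x| = ∫ x, |g x| := by
  have h1 : ∀ x, |dilate g l k x|
      = (2 : ℝ) ^ ((l : ℝ) / 2) * (fun y => |g (y - k)|) ((2 : ℝ) ^ l * x) := fun x => by
    rw [dilate, abs_mul, abs_of_pos (by positivity)]
  simp only [h1, integral_const_mul]
  rw [Measure.integral_comp_mul_left (fun y => |g (y - k)|),
    integral_sub_right_eq_self (fun y => |g y|), ← mul_assoc, ← Real.rpow_add two_pos,
    add_halves, Real.rpow_natCast, smul_eq_mul, abs_of_pos (by positivity), ← mul_assoc,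
    mul_inv_cancel₀ (by positivity), one_mul]

/-- The sum over `ℤ` of the absolute values of the integer translates of a dilated function. -/
def absPeriodisation (g : ℝ → ℝ) (l : ℕ) (k : ℤ) (x : ℝ) : ℝ :=
  ∑' m : ℤ, |dilate g l k (x + m)|

/-- Periodised dilates at resolution `l` of a function with quadratic decay are of order
`2 ^ (l / 2)`. Their `L¹([0,1])`-norm is that of the dilate on `ℝ`, of order `2 ^ (-l / 2)`,
so that they are bounded in `L²([0,1])`. -/
theorem exists_absPeriodisation_le {g : ℝ → ℝ} (hg : Measurable g) {K : ℝ}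
    (hK : ∀ x, |g x| ≤ K / (1 + |x|) ^ 2) : ∃ C : ℝ, 0 ≤ C ∧ ∀ (l : ℕ) (k : ℤ),
      (∀ x, Summable fun m : ℤ => |dilate g l k (x + m)|) ∧
      Measurable (absPeriodisation g l k) ∧
      (∀ x, absPeriodisation g l k x ≤ C * (2 : ℝ) ^ ((l : ℝ) / 2)) ∧
      ∫ x in Icc (0 : ℝ) 1, absPeriodisation g l k x ^ 2 ≤ C := by
  obtain ⟨Q, hQ⟩ := exists_tsum_shift_le
  have hK0 : 0 ≤ K := by simpa using (abs_nonneg _).trans (hK 0)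
  have hQ0 : 0 ≤ Q := (tsum_nonneg fun _ => by positivity).trans (hQ 0).2
  have hgi := integrable_of_decay hg hK
  set I := ∫ x, |g x| with hI
  have hI0 : 0 ≤ I := integral_nonneg fun _ => abs_nonneg _
  refine ⟨K * Q + K * Q * I, by positivity, fun l k => ?_⟩
  set A := absPeriodisation g l k with hA
  have hle : ∀ x : ℝ, ∀ m : ℤ, |dilate g l k (x + m)|
      ≤ (2 : ℝ) ^ ((l : ℝ) / 2) * K * (1 / (1 + |(x - k / 2 ^ l) + m|) ^ 2) := by
    intro x m
    rw [dilate, abs_mul, abs_of_pos (by positivity), mul_assoc, mul_one_div]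
    refine mul_le_mul_of_nonneg_left ((hK _).trans ?_) (by positivity)
    have h1 : |(x - k / 2 ^ l) + m| ≤ |(2 : ℝ) ^ l * (x + m) - k| := by
      have h2 : (2 : ℝ) ^ l * (x + m) - k = 2 ^ l * ((x - k / 2 ^ l) + m) := by
        field_simp; ring
      rw [h2, abs_mul, abs_of_pos (show (0 : ℝ) < 2 ^ l by positivity)]
      exact le_mul_of_one_le_left (abs_nonneg _) (one_le_pow₀ one_le_two)
    gcongr
  have hsum : ∀ x, Summable fun m : ℤ => |dilate g l k (x + m)| := fun x =>
    Summable.of_nonneg_of_le (fun _ => abs_nonneg _) (hle x) ((hQ _).1.mul_left _)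
  have hmeas : ∀ m : ℤ, Measurable fun x : ℝ => |dilate g l k (x + m)| := fun m =>
    ((measurable_dilate hg l k).comp (measurable_id.add_const _)).abs
  have hAm : Measurable A := Measurable.tsum hmeas
  have hA0 : ∀ x, 0 ≤ A x := fun x => tsum_nonneg fun _ => abs_nonneg _
  have hAle : ∀ x, A x ≤ K * Q * (2 : ℝ) ^ ((l : ℝ) / 2) := by
    intro x
    calc A x ≤ ∑' m : ℤ, (2 : ℝ) ^ ((l : ℝ) / 2) * K * (1 / (1 + |(x - k / 2 ^ l) + m|) ^ 2) :=
          (hsum x).tsum_le_tsum (hle x) ((hQ _).1.mul_left _)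
      _ ≤ (2 : ℝ) ^ ((l : ℝ) / 2) * K * Q := by
          rw [tsum_mul_left]
          exact mul_le_mul_of_nonneg_left (hQ _).2 (by positivity)
      _ = _ := by ring
  refine ⟨hsum, hAm, fun x => (hAle x).trans ?_, ?_⟩
  · gcongr
    linarith [show 0 ≤ K * Q * I by positivity]
  have hdi := (integrable_dilate hgi l k).abs
  have h1 := hdi.hasSum_intervalIntegral_comp_add_int
  simp only [intervalIntegral.integral_of_le zero_le_one] at h1
  have h2 : ∫ x in Ioc (0 : ℝ) 1, A x = ∫ x, |dilate g l k x| := by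
    rw [← h1.tsum_eq]
    symm
    refine integral_tsum_of_summable_integral_norm
      (fun m => (hdi.comp_add_right (m : ℝ)).integrableOn) ?_
    simpa only [Real.norm_eq_abs, abs_abs] using h1.summable
  have hAi : IntegrableOn A (Ioc 0 1) := by
    refine Integrable.of_bound hAm.aestronglyMeasurable (K * Q * (2 : ℝ) ^ ((l : ℝ) / 2))
      (Eventually.of_forall fun x => ?_)
    rw [Real.norm_eq_abs, abs_of_nonneg (hA0 x)]
    exact hAle x
  rw [integral_Icc_eq_integral_Ioc]
  calc ∫ x in Ioc (0 : ℝ) 1, A x ^ 2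
      ≤ ∫ x in Ioc (0 : ℝ) 1, K * Q * (2 : ℝ) ^ ((l : ℝ) / 2) * A x := by
        refine integral_mono_of_nonneg (Eventually.of_forall fun x => sq_nonneg _)
          (hAi.const_mul _) (Eventually.of_forall fun x => ?_)
        simp only [sq]
        exact mul_le_mul_of_nonneg_right (hAle x) (hA0 x)
    _ = K * Q * I := by
        rw [integral_const_mul, h2, mul_assoc, integral_abs_dilate]
    _ ≤ _ := by linarith [show 0 ≤ K * Q by positivity]

/-- The properties of the wavelets on which the limit theorem rests: measurability,
`|ψ_{lk}| ≤ C 2 ^ (l / 2)` on `[0,1]`, and a uniform bound in `L²([0,1])`. -/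
structure HasWaveletBounds {J₀ : ℕ} (ψ : WIndex J₀ → ℝ → ℝ) (C : ℝ) : Prop where
  aestronglyMeasurable : ∀ i, AEStronglyMeasurable (ψ i) (volume.restrict (Icc 0 1))
  abs_le : ∀ i, ∀ x ∈ Icc (0 : ℝ) 1, |ψ i x| ≤ C * (2 : ℝ) ^ ((i.level : ℝ) / 2)
  integral_sq_le : ∀ i, ∫ x in Icc (0 : ℝ) 1, ψ i x ^ 2 ≤ C

/-- The scaling functions are dilates by `2 ^ J₀` but have level `J₀ - 1`; this costs a constant. -/
theorem two_rpow_le_of_le_level_add_one {J₀ : ℕ} {i : WIndex J₀} {l : ℕ}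
    (h : (l : ℤ) ≤ i.level + 1) : (2 : ℝ) ^ ((l : ℝ) / 2) ≤ 2 * 2 ^ ((i.level : ℝ) / 2) := by
  have h' : (l : ℝ) ≤ i.level + 1 := by exact_mod_cast h
  have h2 : (2 : ℝ) * 2 ^ ((i.level : ℝ) / 2) = 2 ^ (1 + (i.level : ℝ) / 2) := by
    rw [Real.rpow_add two_pos, Real.rpow_one]
  rw [h2]
  exact Real.rpow_le_rpow_of_exponent_le one_le_two (by linarith)

/-- The wavelet bounds for systems dominated by periodised dilates. This covers the periodised
bases, and also the Haar basis, whose elements are single terms of such sums. -/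
theorem exists_waveletBounds_of_abs_le_absPeriodisation {ψ : WIndex 0 → ℝ → ℝ} {φ' ψ' : ℝ → ℝ}
    (hφ : Measurable φ') (hψ : Measurable ψ') {K : ℝ} (hφK : ∀ x, |φ' x| ≤ K / (1 + |x|) ^ 2)
    (hψK : ∀ x, |ψ' x| ≤ K / (1 + |x|) ^ 2)
    (hm : ∀ i, AEStronglyMeasurable (ψ i) (volume.restrict (Icc 0 1)))
    (h : ∀ i, ∀ x ∈ Icc (0 : ℝ) 1, |ψ i x| ≤ ∑' m : ℤ, |generated φ' ψ' i (x + m)|) :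
    ∃ C, HasWaveletBounds ψ C := by
  obtain ⟨C, hC0, hC⟩ := exists_absPeriodisation_le hφ hφK
  obtain ⟨D, hD0, hD⟩ := exists_absPeriodisation_le hψ hψK
  have key : ∀ i, ∀ A : ℝ → ℝ, ∀ B : ℝ, Measurable A → (∀ x ∈ Icc (0 : ℝ) 1, |ψ i x| ≤ A x) →
      (∀ x, A x ≤ B) → ∫ x in Icc (0 : ℝ) 1, ψ i x ^ 2 ≤ ∫ x in Icc (0 : ℝ) 1, A x ^ 2 := by
    intro i A B hA h1 h2
    have hae : ∀ᵐ x ∂(volume.restrict (Icc (0 : ℝ) 1)), x ∈ Icc (0 : ℝ) 1 :=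
      ae_restrict_mem measurableSet_Icc
    refine integral_mono_of_nonneg (Eventually.of_forall fun x => sq_nonneg _) ?_ ?_
    · refine Integrable.of_bound (hA.pow_const 2).aestronglyMeasurable (B ^ 2) ?_
      filter_upwards [hae] with x hx
      have h3 := (abs_nonneg _).trans (h1 x hx)
      rw [Real.norm_eq_abs, abs_of_nonneg (by positivity)]
      exact pow_le_pow_left₀ h3 (h2 x) 2
    · filter_upwards [hae] with x hx
      rw [← sq_abs]
      exact pow_le_pow_left₀ (abs_nonneg _) (h1 x hx) 2
  refine ⟨2 * C + D, hm, fun i x hx => (h i x hx).trans ?_, fun i => ?_⟩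
  · cases i with
    | scaling k =>
      refine ((hC 0 (k : ℕ)).2.2.1 x).trans ?_
      have := two_rpow_le_of_le_level_add_one (i := .scaling (J₀ := 0) k) (l := 0)
        (by simp [WIndex.level])
      calc C * (2 : ℝ) ^ (((0 : ℕ) : ℝ) / 2)
          ≤ C * (2 * 2 ^ (((WIndex.scaling k).level : ℝ) / 2)) := by gcongr
        _ ≤ _ := by
            rw [← mul_assoc, mul_comm C]
            gcongr
            linarith
    | wavelet l hl k =>
      refine ((hD l (k : ℕ)).2.2.1 x).trans ?_
      simp only [WIndex.level, Int.cast_natCast]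
      gcongr
      linarith
  · cases i with
    | scaling k =>
      have := hC 0 (k : ℕ)
      exact (key _ _ _ this.2.1 (h _) this.2.2.1).trans (this.2.2.2.trans (by linarith))
    | wavelet l hl k =>
      have := hD l (k : ℕ)
      exact (key _ _ _ this.2.1 (h _) this.2.2.1).trans (this.2.2.2.trans (by linarith))

theorem measurable_generated {φ' ψ' : ℝ → ℝ} (hφ : Measurable φ') (hψ : Measurable ψ') {J₀ : ℕ}
    (i : WIndex J₀) : Measurable (generated φ' ψ' i) := by
  cases i with
  | scaling k => exact measurable_dilate hφ _ _
  | wavelet l hl k => exact measurable_dilate hψ _ _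

theorem aestronglyMeasurable_of_eqOn {f g : ℝ → ℝ} (hg : Measurable g)
    (h : EqOn f g (Icc 0 1)) : AEStronglyMeasurable f (volume.restrict (Icc 0 1)) := by
  refine hg.aestronglyMeasurable.congr ?_
  filter_upwards [ae_restrict_mem measurableSet_Icc] with x hx
  exact (h hx).symm

theorem summable_generated {φ' ψ' : ℝ → ℝ} (hφ : Measurable φ') (hψ : Measurable ψ') {K : ℝ}
    (hφK : ∀ x, |φ' x| ≤ K / (1 + |x|) ^ 2) (hψK : ∀ x, |ψ' x| ≤ K / (1 + |x|) ^ 2) {J₀ : ℕ}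
    (i : WIndex J₀) (x : ℝ) : Summable fun m : ℤ => |generated φ' ψ' i (x + m)| := by
  obtain ⟨C, hC0, hC⟩ := exists_absPeriodisation_le hφ hφK
  obtain ⟨D, hD0, hD⟩ := exists_absPeriodisation_le hψ hψK
  cases i with
  | scaling k => exact (hC J₀ (k : ℕ)).1 x
  | wavelet l hl k => exact (hD l (k : ℕ)).1 x

theorem IsHaarBasis.exists_waveletBounds {J₀ : ℕ} {ψ : WIndex J₀ → ℝ → ℝ} (h : IsHaarBasis ψ) :
    ∃ C, HasWaveletBounds ψ C := by
  obtain ⟨rfl, h⟩ := h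
  have hφ : Measurable haarScaling := measurable_one.indicator measurableSet_Ioc
  have hψ : Measurable haarWavelet :=
    (measurable_one.indicator measurableSet_Ioc).sub (measurable_one.indicator measurableSet_Ioc)
  have hle : ∀ x ∈ Ioc (0 : ℝ) 1, 1 ≤ 4 / (1 + |x|) ^ 2 := fun x hx => by
    rw [abs_of_pos hx.1, le_div_iff₀ (by have := hx.1; positivity)]
    nlinarith [hx.1, hx.2]
  have hφK : ∀ x, |haarScaling x| ≤ 4 / (1 + |x|) ^ 2 := fun x => by
    by_cases hx : x ∈ Ioc (0 : ℝ) 1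
    · simpa [haarScaling, hx] using hle x hx
    · simp only [haarScaling, indicator_of_notMem hx, abs_zero]
      positivity
  have hψK : ∀ x, |haarWavelet x| ≤ 4 / (1 + |x|) ^ 2 := fun x => by
    by_cases hx : x ∈ Ioc (0 : ℝ) 1
    · refine le_trans ?_ (hle x hx)
      by_cases hx2 : x ≤ 1 / 2
      · have h1 : x ∈ Ioc (0 : ℝ) (1 / 2) := ⟨hx.1, hx2⟩
        have h2 : x ∉ Ioc (1 / 2 : ℝ) 1 := fun h => absurd h.1 (not_lt.2 hx2)
        simp only [haarWavelet, Pi.sub_apply, indicator_of_mem h1, indicator_of_notMem h2]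
        simp
      · have h1 : x ∉ Ioc (0 : ℝ) (1 / 2) := fun h => hx2 h.2
        have h2 : x ∈ Ioc (1 / 2 : ℝ) 1 := ⟨not_le.1 hx2, hx.2⟩
        simp only [haarWavelet, Pi.sub_apply, indicator_of_mem h2, indicator_of_notMem h1]
        simp
    · have h1 : x ∉ Ioc (0 : ℝ) (1 / 2) := fun h => hx ⟨h.1, h.2.trans (by norm_num)⟩
      have h2 : x ∉ Ioc (1 / 2 : ℝ) 1 := fun h => hx ⟨lt_trans (by norm_num) h.1, h.2⟩
      simp only [haarWavelet, Pi.sub_apply, indicator_of_notMem h1, indicator_of_notMem h2,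
        sub_zero, abs_zero]
      positivity
  refine exists_waveletBounds_of_abs_le_absPeriodisation hφ hψ hφK hψK
    (fun i => aestronglyMeasurable_of_eqOn (measurable_generated hφ hψ i) (h i))
    fun i x hx => ?_
  have := (summable_generated hφ hψ hφK hψK i x).le_tsum 0 fun _ _ => abs_nonneg _
  rw [h i hx]
  simpa using this

theorem IsRegular.measurable {S : ℕ} {g : ℝ → ℝ} (h : IsRegular S g) : Measurable g :=
  h.1.continuous.measurable

theorem IsRegular.exists_decay {S : ℕ} {g : ℝ → ℝ} (h : IsRegular S g) (m : ℕ) :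
    ∃ K, ∀ x, |g x| ≤ K / (1 + |x|) ^ m := by
  simpa using h.2 0 (Nat.zero_le _) m

theorem IsPeriodisedBasis.exists_waveletBounds {S J₀ : ℕ} {ψ : WIndex J₀ → ℝ → ℝ}
    (h : IsPeriodisedBasis S ψ) : ∃ C, HasWaveletBounds ψ C := by
  obtain ⟨rfl, φ', ψ', hpair, h⟩ := h
  obtain ⟨K₁, hK₁⟩ := hpair.regular_scaling.exists_decay 2
  obtain ⟨K₂, hK₂⟩ := hpair.regular_wavelet.exists_decay 2
  have hφ := hpair.regular_scaling.measurable
  have hψ := hpair.regular_wavelet.measurable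
  have hφK : ∀ x, |φ' x| ≤ max K₁ K₂ / (1 + |x|) ^ 2 := fun x =>
    (hK₁ x).trans (by gcongr; exact le_max_left _ _)
  have hψK : ∀ x, |ψ' x| ≤ max K₁ K₂ / (1 + |x|) ^ 2 := fun x =>
    (hK₂ x).trans (by gcongr; exact le_max_right _ _)
  refine exists_waveletBounds_of_abs_le_absPeriodisation hφ hψ hφK hψK
    (fun i => aestronglyMeasurable_of_eqOn ?_ (h i)) fun i x hx => ?_
  · exact Measurable.tsum fun m =>
      (measurable_generated hφ hψ i).comp (measurable_id.add_const (m : ℝ))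
  · rw [h i hx]
    exact norm_tsum_le_tsum_norm (f := fun m : ℤ => generated φ' ψ' i (x + m))
      (summable_generated hφ hψ hφK hψK i x)

theorem exists_abs_le_of_mem_span {s : Set (ℝ → ℝ)} (hs : ∀ g ∈ s, ∃ K, ∀ x, |g x| ≤ K)
    {g : ℝ → ℝ} (hg : g ∈ Submodule.span ℝ s) : ∃ K, ∀ x, |g x| ≤ K := by
  induction hg using Submodule.span_induction with
  | mem g hg => exact hs g hg
  | zero => exact ⟨0, by simp⟩
  | add f g _ _ hf hg =>
    obtain ⟨K, hK⟩ := hf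
    obtain ⟨L, hL⟩ := hg
    exact ⟨K + L, fun x => (abs_add_le _ _).trans (add_le_add (hK x) (hL x))⟩
  | smul c g _ hg =>
    obtain ⟨K, hK⟩ := hg
    refine ⟨|c| * K, fun x => ?_⟩
    rw [Pi.smul_apply, smul_eq_mul, abs_mul]
    exact mul_le_mul_of_nonneg_left (hK x) (abs_nonneg c)

theorem exists_uniform_abs_le {N : ℕ} {g : ℕ → ℝ → ℝ} {s : Set ℝ}
    (h : ∀ k < N, ∃ K, ∀ x ∈ s, |g k x| ≤ K) :
    ∃ K, ∀ k < N, ∀ x ∈ s, |g k x| ≤ K := by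
  choose! K hK using h
  refine ⟨∑ k ∈ Finset.range N, |K k|, fun k hk x hx => (hK k hk x hx).trans ?_⟩
  exact (le_abs_self _).trans (Finset.single_le_sum (f := fun k => |K k|)
    (fun _ _ => abs_nonneg _) (Finset.mem_range.2 hk))

theorem exists_abs_boundaryCorrected_le {N : ℕ} {φ' g : ℝ → ℝ} {gL gR : ℕ → ℝ → ℝ} {c : ℝ}
    (hφ : ∃ K, ∀ x, |φ' x| ≤ K) (hg : ∃ K, ∀ x, |g x| ≤ K)
    (hL : ∀ k < N, ∃ f ∈ Submodule.span ℝ (range fun (m : ℤ) (x : ℝ) => φ' (c * x - m)),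
      EqOn (gL k) f (Ici 0))
    (hR : ∀ k < N, ∃ f ∈ Submodule.span ℝ (range fun (m : ℤ) (x : ℝ) => φ' (c * x - m)),
      EqOn (gR k) f (Iic 0)) :
    ∃ C, 0 ≤ C ∧ ∀ l k : ℕ, k < 2 ^ l → ∀ x ∈ Icc (0 : ℝ) 1,
      |boundaryCorrected N g gL gR l k x| ≤ C * (2 : ℝ) ^ ((l : ℝ) / 2) := by
  have hspan : ∀ f ∈ Submodule.span ℝ (range fun (m : ℤ) (x : ℝ) => φ' (c * x - m)),
      ∃ K, ∀ x, |f x| ≤ K := fun f hf => by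
    refine exists_abs_le_of_mem_span ?_ hf
    rintro _ ⟨m, rfl⟩
    obtain ⟨K, hK⟩ := hφ
    exact ⟨K, fun x => hK _⟩
  obtain ⟨KL, hKL⟩ := exists_uniform_abs_le (s := Ici 0) (g := gL) fun k hk => by
    obtain ⟨f, hf, hfe⟩ := hL k hk
    obtain ⟨K, hK⟩ := hspan f hf
    exact ⟨K, fun x hx => by rw [hfe hx]; exact hK x⟩
  obtain ⟨KR, hKR⟩ := exists_uniform_abs_le (s := Iic 0) (g := gR) fun k hk => by
    obtain ⟨f, hf, hfe⟩ := hR k hk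
    obtain ⟨K, hK⟩ := hspan f hf
    exact ⟨K, fun x hx => by rw [hfe hx]; exact hK x⟩
  obtain ⟨K, hK⟩ := hg
  refine ⟨|K| + |KL| + |KR|, by positivity, fun l k hk x hx => ?_⟩
  have hb : ∀ y, |y| ≤ |K| ∨ |y| ≤ |KL| ∨ |y| ≤ |KR| →
      |(2 : ℝ) ^ ((l : ℝ) / 2) * y| ≤ (|K| + |KL| + |KR|) * (2 : ℝ) ^ ((l : ℝ) / 2) := by
    intro y hy
    rw [abs_mul, abs_of_pos (by positivity), mul_comm]
    gcongr
    have h1 := abs_nonneg K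
    have h2 := abs_nonneg KL
    have h3 := abs_nonneg KR
    rcases hy with hy | hy | hy <;> linarith
  rw [boundaryCorrected]
  split_ifs with h1 h2
  · have : (2 : ℝ) ^ l * x ∈ Ici 0 := mul_nonneg (by positivity) hx.1
    exact hb _ (.inr (.inl ((hKL k h1 _ this).trans (le_abs_self _))))
  · exact hb _ (.inl ((hK _).trans (le_abs_self _)))
  · have : (2 : ℝ) ^ l * (x - 1) ∈ Iic (0 : ℝ) :=
      mem_Iic.2 (mul_nonpos_iff.2 (.inl ⟨by positivity, sub_nonpos.2 hx.2⟩))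
    exact hb _ (.inr (.inr ((hKR _ (by omega) _ this).trans (le_abs_self _))))

/-- The edge functions are bounded as finite linear combinations of translates of the bounded
scaling function; the `L²`-bound is part of orthonormality. -/
theorem IsBoundaryCorrectedBasis.exists_waveletBounds {S J₀ : ℕ} {ψ : WIndex J₀ → ℝ → ℝ}
    (h : IsBoundaryCorrectedBasis S ψ) : ∃ C, HasWaveletBounds ψ C := by
  obtain ⟨N, φ', ψ', φL, φR, ψL, ψR, -, -, hpair, -, -, -, hφL, hφR, hψL, hψR, hsc, hwav, -,
    honb⟩ := h
  have hφb : ∃ K, ∀ x, |φ' x| ≤ K := by simpa using hpair.regular_scaling.exists_decay 0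
  have hψb : ∃ K, ∀ x, |ψ' x| ≤ K := by simpa using hpair.regular_wavelet.exists_decay 0
  obtain ⟨C, hC0, hC⟩ := exists_abs_boundaryCorrected_le (c := 1) hφb hφb
    (by simpa using hφL) (by simpa using hφR)
  obtain ⟨D, hD0, hD⟩ := exists_abs_boundaryCorrected_le (c := 2) hφb hψb hψL hψR
  refine ⟨2 * C + D + 1, fun i => (honb.memLp i).1, fun i x hx => ?_, fun i => ?_⟩
  · cases i with
    | scaling k =>
      rw [hsc k hx]
      refine (hC J₀ k k.2 x hx).trans ?_
      have := two_rpow_le_of_le_level_add_one (i := .scaling (J₀ := J₀) k) (l := J₀)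
        (by simp [WIndex.level])
      calc C * (2 : ℝ) ^ ((J₀ : ℝ) / 2)
          ≤ C * (2 * 2 ^ (((WIndex.scaling k).level : ℝ) / 2)) := by gcongr
        _ ≤ _ := by
            rw [← mul_assoc, mul_comm C]
            gcongr
            linarith
    | wavelet l hl k =>
      rw [hwav l hl k hx]
      refine (hD l k k.2 x hx).trans ?_
      simp only [WIndex.level, Int.cast_natCast]
      gcongr
      linarith
  · have := honb.norm_one i
    simp only [← sq] at this
    rw [this]
    linarith

theorem IsWaveletBasis.exists_waveletBounds {S J₀ : ℕ} {ψ : WIndex J₀ → ℝ → ℝ}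
    (h : IsWaveletBasis S ψ) : ∃ C, HasWaveletBounds ψ C := by
  rcases h with h | h | h
  · exact h.2.exists_waveletBounds
  · exact h.exists_waveletBounds
  · exact h.exists_waveletBounds

/-! ### Wavelets under the sampling distribution -/

/-- What the limit theorem uses about the sampling distribution `P`: bounds for the wavelets in
`L^∞(P)` and `L²(P)` and the decay of the wavelet coefficients of `P`, with a common constant. -/
structure CoefficientBounds {J₀ : ℕ} (P : Measure ℝ) (ψ : WIndex J₀ → ℝ → ℝ) (γ C : ℝ) :
    Prop where
  one_le : 1 ≤ C
  aestronglyMeasurable : ∀ i, AEStronglyMeasurable (ψ i) P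
  ae_abs_le : ∀ i, ∀ᵐ x ∂P, |ψ i x| ≤ C * (2 : ℝ) ^ ((i.level : ℝ) / 2)
  integral_sq_le : ∀ i, ∫ x, ψ i x ^ 2 ∂P ≤ C
  abs_integral_le : ∀ i, |∫ x, ψ i x ∂P| ≤ C * (2 : ℝ) ^ (-((i.level : ℝ) * (γ + 1 / 2)))

theorem HasDensity.integral_eq {P : Measure ℝ} {f : ℝ → ℝ} (hPf : HasDensity P f)
    (hf : ContinuousOn f (Icc 0 1)) (g : ℝ → ℝ) :
    ∫ x, g x ∂P = ∫ x in Icc (0 : ℝ) 1, g x * f x := by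
  have hfm : AEMeasurable f (volume.restrict (Icc 0 1)) :=
    (hf.aestronglyMeasurable measurableSet_Icc).aemeasurable
  rw [hPf.eq_withDensity, integral_withDensity_eq_integral_toReal_smul₀ hfm.ennreal_ofReal
    (Eventually.of_forall fun _ => ENNReal.ofReal_lt_top)]
  refine setIntegral_congr_fun measurableSet_Icc fun x hx => ?_
  simp only [ENNReal.toReal_ofReal (hPf.nonneg x hx), smul_eq_mul, mul_comm]

/-- The density is bounded, being continuous on `[0,1]`, so that `L²`-bounds with respect to
Lebesgue measure carry over to `P`; the coefficients of `P` are those of its density. -/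
theorem HasDensity.exists_coefficientBounds {J₀ : ℕ} {P : Measure ℝ} {f : ℝ → ℝ}
    (hPf : HasDensity P f) {ψ : WIndex J₀ → ℝ → ℝ} {C γ : ℝ} (hψ : HasWaveletBounds ψ C)
    (hf : MemHolderSpace ψ γ f) : ∃ D, CoefficientBounds P ψ γ D := by
  obtain ⟨hfc, D, hD⟩ := hf
  obtain ⟨Λ, hΛ⟩ := isCompact_Icc.exists_bound_of_continuousOn hfc
  have hac : P ≪ volume.restrict (Icc 0 1) := by
    rw [hPf.eq_withDensity]
    exact withDensity_absolutelyContinuous _ _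
  have hae : ∀ᵐ x ∂(volume.restrict (Icc (0 : ℝ) 1)), x ∈ Icc (0 : ℝ) 1 :=
    ae_restrict_mem measurableSet_Icc
  have hΛ0 : 0 ≤ Λ := (norm_nonneg _).trans (hΛ 0 ⟨le_rfl, zero_le_one⟩)
  refine ⟨1 + |C| + |D| + Λ * |C|, ?_, fun i => (hψ.aestronglyMeasurable i).mono_ac hac,
    fun i => ?_, fun i => ?_, fun i => ?_⟩
  · have := abs_nonneg C; have := abs_nonneg D
    linarith [show 0 ≤ Λ * |C| by positivity]
  · filter_upwards [hac.ae_le hae] with x hx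
    refine (hψ.abs_le i x hx).trans ?_
    gcongr
    have := abs_nonneg D; have := le_abs_self C
    linarith [show 0 ≤ Λ * |C| by positivity]
  · have hint : Integrable (fun x => ψ i x ^ 2) (volume.restrict (Icc 0 1)) := by
      refine Integrable.of_bound ((hψ.aestronglyMeasurable i).pow 2)
        ((C * (2 : ℝ) ^ ((i.level : ℝ) / 2)) ^ 2) ?_
      filter_upwards [hae] with x hx
      rw [Real.norm_eq_abs, abs_pow]
      exact pow_le_pow_left₀ (abs_nonneg _) (hψ.abs_le i x hx) 2
    rw [hPf.integral_eq hfc]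
    calc ∫ x in Icc (0 : ℝ) 1, ψ i x ^ 2 * f x ≤ ∫ x in Icc (0 : ℝ) 1, Λ * ψ i x ^ 2 := by
          refine integral_mono_of_nonneg ?_ (hint.const_mul Λ) ?_
          · filter_upwards [hae] with x hx
            exact mul_nonneg (sq_nonneg _) (hPf.nonneg x hx)
          · filter_upwards [hae] with x hx
            rw [mul_comm]
            exact mul_le_mul_of_nonneg_right ((le_abs_self _).trans (hΛ x hx)) (sq_nonneg _)
      _ ≤ Λ * |C| := by
          rw [integral_const_mul]
          exact mul_le_mul_of_nonneg_left ((hψ.integral_sq_le i).trans (le_abs_self C)) hΛ0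
      _ ≤ _ := by
          have := abs_nonneg D; have := abs_nonneg C
          linarith
  · have h1 : (2 : ℝ) ^ ((i.level : ℝ) * (γ + 1 / 2)) * |∫ x in Icc (0 : ℝ) 1, ψ i x * f x| ≤ D :=
      hD (mem_range_self i)
    rw [hPf.integral_eq hfc, Real.rpow_neg two_pos.le, ← div_eq_mul_inv,
      le_div_iff₀ (by positivity), mul_comm]
    refine h1.trans ((le_abs_self D).trans ?_)
    have := abs_nonneg C
    linarith [show 0 ≤ Λ * |C| by positivity]

namespace CoefficientBounds

variable {J₀ : ℕ} {P : Measure ℝ} [IsProbabilityMeasure P] {ψ : WIndex J₀ → ℝ → ℝ} {γ C : ℝ}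

theorem memLp (h : CoefficientBounds P ψ γ C) (i : WIndex J₀) (p : ℝ≥0∞) : MemLp (ψ i) p P :=
  MemLp.of_bound (h.aestronglyMeasurable i) _ (h.ae_abs_le i)

theorem ae_abs_sub_le (h : CoefficientBounds P ψ γ C) (i : WIndex J₀) :
    ∀ᵐ x ∂P, |ψ i x - ∫ y, ψ i y ∂P| ≤ 2 * C * (2 : ℝ) ^ ((i.level : ℝ) / 2) := by
  have h1 : |∫ y, ψ i y ∂P| ≤ C * (2 : ℝ) ^ ((i.level : ℝ) / 2) := by
    simpa using norm_integral_le_of_norm_le_const (μ := P) (f := ψ i) (h.ae_abs_le i)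
  filter_upwards [h.ae_abs_le i] with x hx
  have := abs_sub (ψ i x) (∫ y, ψ i y ∂P)
  linarith

theorem integral_sub_eq_zero (h : CoefficientBounds P ψ γ C) (i : WIndex J₀) :
    ∫ x, (ψ i x - ∫ y, ψ i y ∂P) ∂P = 0 := by
  rw [integral_sub ((h.memLp i 1).integrable le_rfl) (integrable_const _)]
  simp

theorem integral_sub_sq_le (h : CoefficientBounds P ψ γ C) (i : WIndex J₀) :
    ∫ x, (ψ i x - ∫ y, ψ i y ∂P) ^ 2 ∂P ≤ C := by
  rw [← variance_eq_integral (h.aestronglyMeasurable i).aemeasurable]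
  exact (variance_le_expectation_sq (h.aestronglyMeasurable i)).trans (h.integral_sq_le i)

end CoefficientBounds

/-! ### The law of the white bridge -/

open M₀

section Bridge

variable {J₀ : ℕ} {w : Weight J₀} {P : Measure ℝ} {ψ : WIndex J₀ → ℝ → ℝ}

/-- `ν` is the law of the `P`-white bridge on `M₀(w)`, expressed by the one-dimensional laws of
all finite linear combinations of entries. The combinations are indexed by an arbitrary finite
type so that entries may be repeated. -/
def IsBridgeLaw (P : Measure ℝ) (ψ : WIndex J₀ → ℝ → ℝ) (ν : Measure (M₀ w)) : Prop :=
  ∀ (T : Type) [Fintype T] (t : T → WIndex J₀) (c : T → ℝ),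
    ν.map (fun x => ∑ a, c a * entry x (t a))
      = gaussianReal 0 (Var[fun x => ∑ a, c a * ψ (t a) x; P]).toNNReal

/-- By the Cramér–Wold device, the marginals of two bridge laws agree. -/
theorem IsBridgeLaw.unique {ν ν' : Measure (M₀ w)} [IsProbabilityMeasure ν]
    [IsProbabilityMeasure ν'] (h : IsBridgeLaw P ψ ν) (h' : IsBridgeLaw P ψ ν') : ν = ν' := by
  classical
  refine measure_ext fun I => Measure.ext_of_charFunDual ?_
  ext L
  rw [charFunDual_eq_charFun_map_one, charFunDual_eq_charFun_map_one,
    Measure.map_map (by fun_prop) (by fun_prop), Measure.map_map (by fun_prop) (by fun_prop)]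
  have hL : (L ∘ fun (x : M₀ w) (i : I) => entry x i.1)
      = fun x => ∑ i : I, L (fun j => if i = j then 1 else 0) * entry x i.1 := by
    funext x
    simpa [mul_comm] using L.toLinearMap.pi_apply_eq_sum_univ fun i : I => entry x i.1
  rw [hL, h I, h' I]

theorem IsBridgeLaw.isWhiteBridge {ν : Measure (M₀ w)} [IsProbabilityMeasure P]
    [IsProbabilityMeasure ν] (h : IsBridgeLaw P ψ ν) (hψ : ∀ i, MemLp (ψ i) 2 P) :
    IsWhiteBridge P ψ (fun i (x : M₀ w) => (x : MSpace w).coord i) ν := by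
  have hlaw : ∀ (T : Type) [Fintype T] (t : T → WIndex J₀) (c : T → ℝ),
      HasLaw (fun x => ∑ a, c a * entry x (t a))
        (gaussianReal 0 (Var[fun x => ∑ a, c a * ψ (t a) x; P]).toNNReal) ν :=
    fun T _ t c => ⟨by fun_prop, h T t c⟩
  have hlaw1 : ∀ i, HasLaw (fun x : M₀ w => entry x i)
      (gaussianReal 0 (Var[ψ i; P]).toNNReal) ν := fun i => by
    simpa using hlaw Unit (fun _ => i) 1
  have hmem : ∀ i, MemLp (fun x : M₀ w => entry x i) 2 ν := fun i => by
    have := memLp_id_gaussianReal (μ := 0) (v := (Var[ψ i; P]).toNNReal) 2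
    rw [← (hlaw1 i).map_eq, memLp_map_measure_iff aestronglyMeasurable_id
      (hlaw1 i).aemeasurable] at this
    exact this
  have hmean : ∀ i, ∫ x : M₀ w, entry x i ∂ν = 0 := fun i => by
    rw [(hlaw1 i).integral_eq, integral_id_gaussianReal]
  have hvar : ∀ i, Var[fun x : M₀ w => entry x i; ν] = Var[ψ i; P] := fun i => by
    rw [(hlaw1 i).variance_eq, variance_id_gaussianReal, Real.coe_toNNReal _ (variance_nonneg _ _)]
  refine ⟨hψ, ⟨fun I => ⟨isGaussian_of_isGaussian_map fun L => ?_⟩⟩, hmean, fun i i' => ?_⟩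
  · classical
    have hm : Measurable fun (x : M₀ w) => I.restrict fun i => (x : MSpace w).coord i :=
      measurable_pi_lambda _ fun i => measurable_entry i.1
    rw [Measure.map_map (by fun_prop) hm]
    have hL : (L ∘ fun (x : M₀ w) => I.restrict fun i => (x : MSpace w).coord i)
        = fun x => ∑ i : I, L (fun j => if i = j then 1 else 0) * entry x i.1 := by
      funext x
      change L (fun i : I => entry x i.1) = _
      simpa [mul_comm] using L.toLinearMap.pi_apply_eq_sum_univ fun i : I => entry x i.1
    rw [hL, h I]
    infer_instance
  · -- the covariances are determined by the variances of sums of two entries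
    have h1 := hlaw Bool (fun a => if a then i else i') 1
    simp only [Fintype.sum_bool, Pi.one_apply, one_mul, if_true, Bool.false_eq_true,
      if_false] at h1
    have h2 := h1.variance_eq
    rw [variance_id_gaussianReal, Real.coe_toNNReal _ (variance_nonneg _ _),
      variance_fun_add (hmem i) (hmem i'), variance_fun_add (hψ i) (hψ i'), hvar, hvar] at h2
    have h3 : cov[fun x : M₀ w => entry x i, fun x => entry x i'; ν] = cov[ψ i, ψ i'; P] := by
      linarith
    simp only [covariance, hmean, sub_zero] at h3
    exact h3

end Bridge

open M₀

/-! ### The projected empirical process -/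

section Empirical

variable {J₀ : ℕ} {w : Weight J₀} {P : Measure ℝ} {ψ : WIndex J₀ → ℝ → ℝ} {γ C : ℝ}
  {Ω : Type*} {X : ℕ → Ω → ℝ}

/-- The coefficients of `√n (P_n(j) - P)`. -/
def scaledError (P : Measure ℝ) (ψ : WIndex J₀ → ℝ → ℝ) (X : ℕ → Ω → ℝ) (n : ℕ) (j : ℤ) (ω : Ω)
    (i : WIndex J₀) : ℝ :=
  √(n : ℝ) * (empiricalCoeff ψ X n j ω i - ∫ x, ψ i x ∂P)

theorem scaledError_of_level_le {n : ℕ} {j : ℤ} {i : WIndex J₀} (h : i.level ≤ j) (ω : Ω) :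
    scaledError P ψ X n j ω i
      = (√(n : ℝ))⁻¹ * ∑ m ∈ Finset.range n, (ψ i (X m ω) - ∫ x, ψ i x ∂P) := by
  rw [scaledError, empiricalCoeff, if_pos h, Finset.sum_sub_distrib, Finset.sum_const,
    Finset.card_range, nsmul_eq_mul]
  rcases Nat.eq_zero_or_pos n with rfl | hn
  · simp
  · have h1 : (0 : ℝ) < n := by exact_mod_cast hn
    have h2 : (0 : ℝ) < √(n : ℝ) := Real.sqrt_pos.2 h1
    have h3 : √(n : ℝ) * √(n : ℝ) = n := Real.mul_self_sqrt h1.le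
    rw [eq_inv_mul_iff_mul_eq₀ h2.ne', ← mul_assoc, h3, mul_sub, mul_inv_cancel_left₀ h1.ne']

theorem scaledError_of_lt_level {n : ℕ} {j : ℤ} {i : WIndex J₀} (h : j < i.level) (ω : Ω) :
    scaledError P ψ X n j ω i = -(√(n : ℝ) * ∫ x, ψ i x ∂P) := by
  rw [scaledError, empiricalCoeff, if_neg (not_le.2 h)]
  ring

theorem tendsto_abs_integral_div (h : CoefficientBounds P ψ γ C) (hγ : 0 ≤ γ) (a : ℝ) :
    Tendsto (fun i : WIndex J₀ => |-(a * ∫ x, ψ i x ∂P)| / w i.level) cofinite (𝓝 0) := by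
  have h1 : Tendsto (fun i : WIndex J₀ => (i.level : ℝ) * (γ + 1 / 2)) cofinite atTop :=
    (tendsto_intCast_atTop_atTop.comp WIndex.tendsto_level).atTop_mul_const (by positivity)
  have h2 := ((tendsto_rpow_atBot_of_base_gt_one 2 one_lt_two).comp
    (tendsto_neg_atTop_atBot.comp h1)).const_mul (|a| * C)
  rw [mul_zero] at h2
  refine squeeze_zero (fun i => div_nonneg (abs_nonneg _) (w.pos i).le) (fun i => ?_) h2
  refine (div_le_self (abs_nonneg _) (w.one_le _ i.le_level)).trans ?_
  rw [abs_neg, abs_mul, mul_assoc]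
  exact mul_le_mul_of_nonneg_left (h.abs_integral_le i) (abs_nonneg a)

/-- The part of `√n (P_n(j) - P)` above level `j`, which is deterministic. -/
def biasTerm (h : CoefficientBounds P ψ γ C) (hγ : 0 ≤ γ) (w : Weight J₀) (n : ℕ) (j : ℤ) :
    M₀ w :=
  mk (fun i => if i.level ≤ j then 0 else -(√(n : ℝ) * ∫ x, ψ i x ∂P))
    (squeeze_zero (fun i => div_nonneg (abs_nonneg _) (w.pos i).le)
      (fun i => div_le_div_of_nonneg_right
        (by split_ifs <;> simp only [abs_zero, abs_nonneg, le_refl]) (w.pos i).le)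
      (tendsto_abs_integral_div h hγ √(n : ℝ)))

theorem norm_biasTerm_le (h : CoefficientBounds P ψ γ C) (hγ : 0 ≤ γ) {n : ℕ} {j : ℤ}
    (hj : (J₀ : ℤ) - 1 ≤ j) : ‖biasTerm h hγ w n j‖
      ≤ C * (√(n : ℝ) * (2 : ℝ) ^ (-((j : ℝ) * (γ + 1 / 2))) / w j) := by
  have hC := h.one_le
  have hwj : 0 < w j := one_pos.trans_le (w.one_le j hj)
  refine norm_le fun i => ?_
  simp only [biasTerm, entry_mk]
  split_ifs with hi
  · rw [abs_zero]
    have := w.pos i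
    positivity
  · have hi' : j ≤ i.level := (not_le.1 hi).le
    have h1 : w j ≤ w i.level := w.monotoneOn hj i.le_level hi'
    have h2 : (j : ℝ) ≤ i.level := by exact_mod_cast hi'
    calc |-(√(n : ℝ) * ∫ x, ψ i x ∂P)|
        ≤ √(n : ℝ) * (C * (2 : ℝ) ^ (-((i.level : ℝ) * (γ + 1 / 2)))) := by
          rw [abs_neg, abs_mul, abs_of_nonneg (Real.sqrt_nonneg _)]
          exact mul_le_mul_of_nonneg_left (h.abs_integral_le i) (Real.sqrt_nonneg _)
      _ ≤ √(n : ℝ) * (C * (2 : ℝ) ^ (-((j : ℝ) * (γ + 1 / 2)))) := by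
          gcongr
          exact one_le_two
      _ = C * (√(n : ℝ) * (2 : ℝ) ^ (-((j : ℝ) * (γ + 1 / 2))) / w j) * w j := by
          field_simp
      _ ≤ _ := by gcongr

/-- The bias condition forces the resolution levels to tend to infinity. -/
theorem tendsto_resolution_atTop (hγ : 0 ≤ γ) {j : ℕ → ℤ} (hj : ∀ n, (J₀ : ℤ) - 1 ≤ j n)
    (hj_bias : Tendsto (fun n : ℕ => √(n : ℝ) * (2 : ℝ) ^ (-((j n : ℝ) * (γ + 1 / 2))) / w (j n))
      atTop (𝓝 0)) : Tendsto j atTop atTop := by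
  rw [tendsto_atTop]
  intro L
  set L' := max L ((J₀ : ℤ) - 1)
  have hw' : 0 < w L' := one_pos.trans_le (w.one_le L' (le_max_right _ _))
  set κ := (2 : ℝ) ^ (-((L' : ℝ) * (γ + 1 / 2))) / w L' with hκ
  have hκ0 : 0 < κ := by positivity
  have h1 : Tendsto (fun n : ℕ => √(n : ℝ) * κ) atTop atTop :=
    (Real.tendsto_sqrt_atTop.comp tendsto_natCast_atTop_atTop).atTop_mul_const hκ0
  filter_upwards [h1.eventually_ge_atTop 1, hj_bias.eventually_lt_const one_pos] with n hn1 hn2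
  by_contra! hlt
  have hle : j n ≤ L' := hlt.le.trans (le_max_left _ _)
  have hle' : (j n : ℝ) ≤ L' := by exact_mod_cast hle
  have hwn : 0 < w (j n) := one_pos.trans_le (w.one_le _ (hj n))
  have h2 : √(n : ℝ) * κ ≤ √(n : ℝ) * (2 : ℝ) ^ (-((j n : ℝ) * (γ + 1 / 2))) / w (j n) := by
    rw [hκ, mul_div_assoc]
    gcongr
    · exact one_le_two
    · exact w.monotoneOn (hj n) (mem_Ici.2 (le_max_right _ _)) hle
  linarith

variable [MeasurableSpace Ω] {μ : Measure Ω}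

theorem CoefficientBounds.aemeasurable_comp (h : CoefficientBounds P ψ γ C)
    (hX : ∀ m, HasLaw (X m) P μ) (i : WIndex J₀) (m : ℕ) :
    AEMeasurable (fun ω => ψ i (X m ω)) μ := by
  refine AEMeasurable.comp_aemeasurable ?_ (hX m).aemeasurable
  rw [(hX m).map_eq]
  exact (h.aestronglyMeasurable i).aemeasurable

theorem CoefficientBounds.aemeasurable_empiricalCoeff (h : CoefficientBounds P ψ γ C)
    (hX : ∀ m, HasLaw (X m) P μ) (n : ℕ) (j : ℤ) (i : WIndex J₀) :
    AEMeasurable (fun ω => empiricalCoeff ψ X n j ω i) μ := by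
  unfold empiricalCoeff
  split_ifs
  · exact (Finset.aemeasurable_fun_sum _ fun m _ => h.aemeasurable_comp hX i m).const_mul _
  · exact aemeasurable_const

/-- `√n (P_n(j) - P)` as a random element of `M₀(w)`: the empirical part has finitely many nonzero
entries, and `P` is a fixed element of `M₀(w)`. -/
theorem exists_scaledError_process (h : CoefficientBounds P ψ γ C) (hγ : 0 ≤ γ)
    (hX : ∀ m, HasLaw (X m) P μ) (w : Weight J₀) (n : ℕ) (j : ℤ) :
    ∃ Y : Ω → M₀ w, AEMeasurable Y μ ∧ ∀ ω i, entry (Y ω) i = scaledError P ψ X n j ω i := by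
  set I := (WIndex.finite_level_le (J₀ := J₀) j).toFinset
  refine ⟨fun ω => extend I (fun i => √(n : ℝ) * empiricalCoeff ψ X n j ω i)
    + mk (fun i => -(√(n : ℝ) * ∫ x, ψ i x ∂P)) (tendsto_abs_integral_div h hγ _), ?_,
    fun ω i => ?_⟩
  · have hc : Continuous fun y : I → ℝ => extend (w := w) I y
        + mk (fun i => -(√(n : ℝ) * ∫ x, ψ i x ∂P)) (tendsto_abs_integral_div h hγ _) := by
      fun_prop
    exact hc.measurable.comp_aemeasurable (aemeasurable_pi_lambda _ fun i =>
      (h.aemeasurable_empiricalCoeff hX n j i).const_mul _)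
  · rw [entry_add, entry_mk]
    by_cases hi : i.level ≤ j
    · have hI : i ∈ I := by simpa [I] using hi
      rw [entry_extend_of_mem _ hI, scaledError]
      ring
    · have hI : i ∉ I := by simpa [I] using hi
      rw [entry_extend_of_notMem _ hI, scaledError_of_lt_level (not_le.1 hi), zero_add]

/-! ### Tightness -/

variable [IsProbabilityMeasure μ] [IsProbabilityMeasure P]

/-- The Chernoff bound for a single coefficient. -/
theorem CoefficientBounds.measureReal_le_abs_scaledError_le (h : CoefficientBounds P ψ γ C)
    (hX : ∀ m, HasLaw (X m) P μ) (hindep : iIndepFun X μ) {n : ℕ} (hn : 0 < n) {j : ℤ}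
    {i : WIndex J₀} (hi : i.level ≤ j) {s : ℝ} (hs0 : 0 ≤ s)
    (hs : s * (2 * C * (2 : ℝ) ^ ((i.level : ℝ) / 2)) ≤ √(n : ℝ)) (b : ℝ) :
    μ.real {ω | b ≤ |scaledError P ψ X n j ω i|} ≤ 2 * Real.exp (-s * b + s ^ 2 * C) := by
  have hn' : (0 : ℝ) < n := by exact_mod_cast hn
  have hsq : 0 < √(n : ℝ) := Real.sqrt_pos.2 hn'
  have hm : AEStronglyMeasurable (fun x => ψ i x - ∫ y, ψ i y ∂P) P :=
    (h.aestronglyMeasurable i).sub aestronglyMeasurable_const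
  have key := measureReal_le_abs_sum_le
    (Y := fun m ω => ψ i (X m ω) - ∫ y, ψ i y ∂P) (μ := μ)
    (B := 2 * C * (2 : ℝ) ^ ((i.level : ℝ) / 2)) (v := C) (s := s / √(n : ℝ))
    (fun m => (h.aemeasurable_comp hX i m).sub_const _)
    (hindep.comp₀ (fun _ x => ψ i x - ∫ y, ψ i y ∂P) (fun m => (hX m).aemeasurable)
      fun m => by rw [(hX m).map_eq]; exact hm.aemeasurable)
    (fun m => ae_of_ae_map (hX m).aemeasurable
      (by rw [(hX m).map_eq]; exact h.ae_abs_sub_le i))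
    (fun m => ((hX m).integral_comp hm).trans (h.integral_sub_eq_zero i))
    (fun m => ((hX m).integral_comp (hm.pow 2)).le.trans (h.integral_sub_sq_le i))
    (by positivity) (by rw [div_mul_eq_mul_div, div_le_one hsq]; exact hs) n (√(n : ℝ) * b)
  have hset : {ω | b ≤ |scaledError P ψ X n j ω i|}
      = {ω | √(n : ℝ) * b ≤ |∑ m ∈ Finset.range n, (ψ i (X m ω) - ∫ y, ψ i y ∂P)|} := by
    ext ω
    simp only [mem_ofPred_eq]
    rw [scaledError_of_level_le hi, abs_mul, abs_inv, abs_of_pos hsq, le_inv_mul_iff₀ hsq]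
  have hexp : -(s / √(n : ℝ)) * (√(n : ℝ) * b) + n * ((s / √(n : ℝ)) ^ 2 * C)
      = -s * b + s ^ 2 * C := by
    rw [div_pow, Real.sq_sqrt hn'.le]
    field_simp
  rw [hset]
  rwa [hexp] at key

theorem sqrt_mul_two_rpow_le {K : ℝ} {n : ℕ} {j l : ℤ} (hl : 1 ≤ l) (hlj : l ≤ j)
    (hK : (2 : ℝ) ^ j * (j : ℝ) ≤ K * n) :
    √(l : ℝ) * (2 : ℝ) ^ ((l : ℝ) / 2) ≤ √K * √(n : ℝ) := by
  have hl0 : (0 : ℝ) ≤ l := by exact_mod_cast (zero_le_one.trans hl)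
  have hlj' : (l : ℝ) ≤ j := by exact_mod_cast hlj
  have h1 : (2 : ℝ) ^ ((l : ℝ) / 2) = √((2 : ℝ) ^ l) := by
    rw [Real.sqrt_eq_rpow, ← Real.rpow_intCast, ← Real.rpow_mul two_pos.le]
    ring_nf
  rw [h1, ← Real.sqrt_mul hl0, ← Real.sqrt_mul' _ (Nat.cast_nonneg n)]
  refine Real.sqrt_le_sqrt (le_trans ?_ hK)
  rw [mul_comm]
  gcongr
  exact one_le_two

/-- Thresholds `b_i = o(w_i)` which the entries of `√n (P_n(j_n) - P)` of level at most `j_n`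
exceed with summable, uniformly small probability. At levels `l ≥ 1` they are `M √l`: by the
variance condition on `j_n` the Chernoff bound is available with parameter of order `√l`. -/
theorem exists_thresholds (hw : w.Admissible) (h : CoefficientBounds P ψ γ C)
    (hX : ∀ m, HasLaw (X m) P μ) (hindep : iIndepFun X μ) {j : ℕ → ℤ} {N : ℕ} (hN : 0 < N)
    {K : ℝ} (hK0 : 0 < K) (hK : ∀ n ≥ N, (2 : ℝ) ^ (j n) * (j n : ℝ) ≤ K * n) {r : ℝ}
    (hr : 0 ≤ r) :
    ∃ b : WIndex J₀ → ℝ, (∀ i, 0 ≤ b i) ∧ Tendsto (fun i => b i / w i.level) cofinite (𝓝 0) ∧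
      ∀ n ≥ N, ∀ i, i.level ≤ j n →
        μ.real {ω | b i ≤ |scaledError P ψ X n (j n) ω i|}
          ≤ 2 * Real.exp (-r) * Real.exp (-3 * i.level) := by
  have hC : 0 < C := one_pos.trans_le h.one_le
  have hsK : 0 < √K := Real.sqrt_pos.2 hK0
  -- With parameter `c √l` the exponent at the threshold `M √l` is `(c ^ 2 C - c M) l`; the constant
  -- `c` makes the parameter admissible, and `M` makes the exponent equal to `-(3 + r) l`.
  set c := 1 / (2 * C * √K) with hc
  have hc0 : 0 < c := by positivity
  set M := c * C + (3 + r) / c with hM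
  have hM0 : 0 ≤ M := by positivity
  -- At the finitely many lower levels any fixed admissible parameter does.
  set s : WIndex J₀ → ℝ := fun i => 1 / (2 * C * (2 : ℝ) ^ ((i.level : ℝ) / 2)) with hs
  have hs0 : ∀ i, 0 < s i := fun i => by positivity
  refine ⟨fun i => if 1 ≤ i.level then M * √(i.level : ℝ)
    else (s i ^ 2 * C + |3 * i.level + r|) / s i, fun i => ?_, ?_, fun n hn i hi => ?_⟩
  · have := hs0 i
    beta_reduce
    split_ifs <;> positivity
  · have h1 : Tendsto (fun i : WIndex J₀ => M * (w i.level / √(i.level : ℝ))⁻¹) cofinite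
        (𝓝 (M * 0)) :=
      (tendsto_inv_atTop_zero.comp (hw.2.comp WIndex.tendsto_level)).const_mul M
    rw [mul_zero] at h1
    refine h1.congr' ?_
    filter_upwards [WIndex.tendsto_level.eventually_ge_atTop 1] with i hi
    rw [if_pos hi, inv_div, mul_div_assoc]
  · have hn0 : 0 < n := hN.trans_le hn
    rw [mul_assoc, ← Real.exp_add]
    beta_reduce
    split_ifs with h1
    · have hl : (1 : ℝ) ≤ i.level := by exact_mod_cast h1
      have hl0 : (0 : ℝ) ≤ i.level := zero_le_one.trans hl
      refine (h.measureReal_le_abs_scaledError_le hX hindep hn0 hi (s := c * √(i.level : ℝ))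
        (by positivity) ?_ _).trans ?_
      · calc c * √(i.level : ℝ) * (2 * C * (2 : ℝ) ^ ((i.level : ℝ) / 2))
            = c * (2 * C) * (√(i.level : ℝ) * (2 : ℝ) ^ ((i.level : ℝ) / 2)) := by ring
          _ ≤ c * (2 * C) * (√K * √(n : ℝ)) := by
              exact mul_le_mul_of_nonneg_left (sqrt_mul_two_rpow_le h1 hi (hK n hn))
                (by positivity)
          _ = √(n : ℝ) := by
              rw [hc]; field_simp
      · refine mul_le_mul_of_nonneg_left (Real.exp_le_exp.2 ?_) two_pos.le
        have h2 : √(i.level : ℝ) * √(i.level : ℝ) = i.level := Real.mul_self_sqrt hl0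
        have h3 : c * M = c ^ 2 * C + (3 + r) := by
          rw [hM]; field_simp
        calc -(c * √(i.level : ℝ)) * (M * √(i.level : ℝ)) + (c * √(i.level : ℝ)) ^ 2 * C
            = (-(c * M) + c ^ 2 * C) * (√(i.level : ℝ) * √(i.level : ℝ)) := by ring
          _ = -(3 + r) * i.level := by rw [h2, h3]; ring
          _ ≤ _ := by nlinarith
    · refine (h.measureReal_le_abs_scaledError_le hX hindep hn0 hi (hs0 i).le ?_ _).trans ?_
      · rw [hs]
        simp only
        rw [one_div_mul_cancel (by positivity), Real.one_le_sqrt]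
        exact_mod_cast hn0
      · refine mul_le_mul_of_nonneg_left (Real.exp_le_exp.2 ?_) two_pos.le
        have h2 : -s i * ((s i ^ 2 * C + |3 * (i.level : ℝ) + r|) / s i)
            = -(s i ^ 2 * C + |3 * (i.level : ℝ) + r|) := by
          have := (hs0 i).ne'
          field_simp
        rw [h2]
        linarith [le_abs_self (3 * (i.level : ℝ) + r)]

open scoped Pointwise in
/-- The laws of `√n (P_n(j_n) - P)`, `n ≥ N`, are tight in `M₀(w)`: up to small probability the
levels up to `j_n` lie in a compact box, and the bias terms form a convergent sequence. -/
theorem isTightMeasureSet_scaledError (hw : w.Admissible) (h : CoefficientBounds P ψ γ C)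
    (hγ : 0 ≤ γ) (hX : ∀ m, HasLaw (X m) P μ) (hindep : iIndepFun X μ)
    {j : ℕ → ℤ} (hj : ∀ n, (J₀ : ℤ) - 1 ≤ j n)
    (hj_bias : Tendsto (fun n : ℕ => √(n : ℝ) * (2 : ℝ) ^ (-((j n : ℝ) * (γ + 1 / 2))) / w (j n))
      atTop (𝓝 0)) {N : ℕ} (hN : 0 < N)
    {K : ℝ} (hK0 : 0 < K) (hK : ∀ n ≥ N, (2 : ℝ) ^ (j n) * (j n : ℝ) ≤ K * n)
    {Y : ℕ → Ω → M₀ w} (hYm : ∀ n, AEMeasurable (Y n) μ)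
    (hY : ∀ n ω i, entry (Y n ω) i = scaledError P ψ X n (j n) ω i) :
    IsTightMeasureSet {ρ | ∃ n ≥ N, μ.map (Y n) = ρ} := by
  rw [isTightMeasureSet_iff_exists_isCompact_measure_compl_le]
  intro ε hε
  set B : ℕ → M₀ w := fun n => biasTerm h hγ w n (j n) with hB
  have hBlim : Tendsto B atTop (𝓝 0) := by
    refine squeeze_zero_norm (fun n => norm_biasTerm_le h hγ (hj n)) ?_
    simpa using hj_bias.const_mul C
  -- a multiple of `exp (-r)` below `ε`
  obtain ⟨r, hr, hrε⟩ : ∃ r : ℝ, 0 ≤ r ∧ ENNReal.ofReal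
      (2 * Real.exp (-r) * ∑' i : WIndex J₀, Real.exp (-3 * i.level)) ≤ ε := by
    have h1 : Tendsto (fun r : ℝ => ENNReal.ofReal
        (2 * Real.exp (-r) * ∑' i : WIndex J₀, Real.exp (-3 * i.level))) atTop (𝓝 0) := by
      have := ENNReal.tendsto_ofReal ((Real.tendsto_exp_neg_atTop_nhds_zero.const_mul 2).mul_const
        (∑' i : WIndex J₀, Real.exp (-3 * i.level)))
      simpa using this
    obtain ⟨r, hr1, hr2⟩ := ((h1.eventually_lt_const hε).and (eventually_ge_atTop 0)).exists
    exact ⟨r, hr2, hr1.le⟩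
  obtain ⟨b, hb0, hb, hbprob⟩ := exists_thresholds hw h hX hindep hN hK0 hK hr
  have hKc : IsCompact ({x : M₀ w | ∀ i, |entry x i| ≤ b i} + insert 0 (range B)) :=
    (isCompact_box hb).add hBlim.isCompact_insert_range
  refine ⟨_, hKc, ?_⟩
  rintro _ ⟨n, hn, rfl⟩
  rw [Measure.map_apply_of_aemeasurable (hYm n) hKc.isClosed.measurableSet.compl]
  have hsub : Y n ⁻¹' ({x : M₀ w | ∀ i, |entry x i| ≤ b i} + insert 0 (range B))ᶜ
      ⊆ ⋃ i, {ω | i.level ≤ j n ∧ b i ≤ |scaledError P ψ X n (j n) ω i|} := by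
    intro ω hω
    by_contra hω'
    simp only [mem_iUnion, mem_ofPred_eq, not_exists, not_and, not_le] at hω'
    refine hω (Set.mem_add.2 ⟨Y n ω - B n, fun i => ?_, B n, .inr (mem_range_self n),
      sub_add_cancel _ _⟩)
    rw [entry_sub, hY]
    simp only [hB, biasTerm, entry_mk]
    split_ifs with hi
    · rw [sub_zero]
      exact (hω' i hi).le
    · rw [scaledError_of_lt_level (not_le.1 hi), sub_self, abs_zero]
      exact hb0 i
  calc μ (Y n ⁻¹' ({x : M₀ w | ∀ i, |entry x i| ≤ b i} + insert 0 (range B))ᶜ)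
      ≤ ∑' i, μ {ω | i.level ≤ j n ∧ b i ≤ |scaledError P ψ X n (j n) ω i|} :=
        (measure_mono hsub).trans (measure_iUnion_le _)
    _ ≤ ∑' i : WIndex J₀, ENNReal.ofReal (2 * Real.exp (-r) * Real.exp (-3 * i.level)) := by
        refine ENNReal.tsum_le_tsum fun i => ?_
        by_cases hi : i.level ≤ j n
        · simp only [hi, true_and]
          rw [← ofReal_measureReal]
          exact ENNReal.ofReal_le_ofReal (hbprob n hn i hi)
        · simp [hi]
    _ ≤ ε := by
        rw [← ENNReal.ofReal_tsum_of_nonneg (fun i => by positivity)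
          (WIndex.summable_exp_level.mul_left _), tsum_mul_left]
        exact hrε

/-! ### Finite-dimensional convergence and the limit theorem -/

/-- The central limit theorem for finite linear combinations of coefficients. -/
theorem tendsto_map_combination (h : CoefficientBounds P ψ γ C) (hX : ∀ m, HasLaw (X m) P μ)
    (hindep : iIndepFun X μ) {j : ℕ → ℤ} (hj : Tendsto j atTop atTop) {T : Type} [Fintype T]
    (t : T → WIndex J₀) (c : T → ℝ) (hm : ∀ n, AEMeasurable
      (fun ω => ∑ a, c a * scaledError P ψ X n (j n) ω (t a)) μ) :
    Tendsto (β := ProbabilityMeasure ℝ)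
      (fun n => ⟨μ.map (fun ω => ∑ a, c a * scaledError P ψ X n (j n) ω (t a)),
        Measure.isProbabilityMeasure_map (hm n)⟩) atTop
      (𝓝 ⟨gaussianReal 0 (Var[fun x => ∑ a, c a * ψ (t a) x; P]).toNNReal, inferInstance⟩) := by
  set H : ℝ → ℝ := fun x => ∑ a, c a * ψ (t a) x with hH
  have hHmem : MemLp H 2 P := memLp_finsetSum _ fun a _ => (h.memLp (t a) 2).const_mul (c a)
  have hHint : ∫ x, H x ∂P = ∑ a, c a * ∫ x, ψ (t a) x ∂P := by
    rw [hH, integral_finsetSum _ fun a _ =>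
      ((h.memLp (t a) 1).integrable le_rfl).const_mul (c a)]
    simp only [integral_const_mul]
  have hHm : ∀ m, AEMeasurable H (μ.map (X m)) := fun m => by
    rw [(hX m).map_eq]
    exact hHmem.1.aemeasurable
  have hlaw : ∀ m, HasLaw (H ∘ X m) (P.map H) μ := fun m =>
    HasLaw.comp ⟨hHmem.1.aemeasurable, rfl⟩ (hX m)
  have hvar : Var[H ∘ X 0; μ] = Var[H; P] := by
    rw [← variance_map (hHm 0) (hX 0).aemeasurable, (hX 0).map_eq]
  have hmean : ∫ ω, (H ∘ X 0) ω ∂μ = ∫ x, H x ∂P := (hX 0).integral_comp hHmem.1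
  have hmem : MemLp (H ∘ X 0) 2 μ := by
    rw [← memLp_map_measure_iff (hHm 0).aestronglyMeasurable (hX 0).aemeasurable, (hX 0).map_eq]
    exact hHmem
  have hclt := tendstoInDistribution_inv_sqrt_mul_sum_sub (X := fun m => H ∘ X m) (P := μ)
    (P' := gaussianReal 0 (Var[H; P]).toNNReal) (Y := id)
    (by rw [hvar]; exact ⟨aemeasurable_id, Measure.map_id⟩) hmem
    (hindep.comp₀ (fun _ => H) (fun m => (hX m).aemeasurable) hHm)
    (fun m => (hlaw m).identDistrib (hlaw 0))
  have hlim := hclt.tendsto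
  simp only [Measure.map_id] at hlim
  refine hlim.congr' ?_
  have hlev : ∀ᶠ n in atTop, ∀ a, (t a).level ≤ j n :=
    eventually_all.2 fun a => hj.eventually_ge_atTop _
  filter_upwards [hlev] with n hn
  refine Subtype.ext (congrArg μ.map (funext fun ω => ?_))
  simp only [scaledError_of_level_le (hn _), hmean, hHint]
  simp only [Function.comp_apply, hH, Finset.sum_sub_distrib, Finset.sum_const,
    Finset.card_range, nsmul_eq_mul]
  rw [Finset.sum_comm, Finset.mul_sum, ← Finset.sum_sub_distrib, Finset.mul_sum]
  refine Finset.sum_congr rfl fun a _ => ?_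
  rw [← Finset.mul_sum]
  ring

end Empirical

end Multiscale

end

theorem theorem1 {S J₀ : ℕ} {ψ : WIndex J₀ → ℝ → ℝ} (hψ : IsWaveletBasis S ψ)
    {w : Weight J₀} (hw : w.Admissible)
    {P : Measure ℝ} {f : ℝ → ℝ} {γ : ℝ} (hγ : 0 ≤ γ) (hPf : HasDensity P f)
    (hf : MemHolderSpace ψ γ f)
    {Ω : Type*} [MeasurableSpace Ω] {μ : Measure Ω} [IsProbabilityMeasure μ]
    {X : ℕ → Ω → ℝ} (hX : ∀ m, HasLaw (X m) P μ) (hindep : iIndepFun X μ)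
    {j : ℕ → ℤ} (hj : ∀ n, (J₀ : ℤ) - 1 ≤ j n)
    (hj_bias : Tendsto (fun n : ℕ => √(n : ℝ) * (2 : ℝ) ^ (-((j n : ℝ) * (γ + 1 / 2))) / w (j n))
      atTop (𝓝 0))
    (hj_var : (fun n : ℕ => (2 : ℝ) ^ (j n) * (j n : ℝ) / (n : ℝ)) =O[atTop]
      (fun _ => (1 : ℝ))) :
    ∃ (Y : ℕ → Ω → M₀ w) (𝔾 : Measure (M₀ w)) (_ : IsProbabilityMeasure 𝔾),
      (∀ n ω i, (Y n ω : MSpace w).coord i =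
        √(n : ℝ) * (empiricalCoeff ψ X n (j n) ω i - ∫ x, ψ i x ∂P)) ∧
      IsWhiteBridge P ψ (fun i (x : M₀ w) => (x : MSpace w).coord i) 𝔾 ∧
      TendstoInDistribution Y atTop (id : M₀ w → M₀ w) (fun _ => μ) 𝔾 := by
  have hP : IsProbabilityMeasure P := hPf.isProbabilityMeasure
  obtain ⟨_, hbd⟩ := hψ.exists_waveletBounds
  obtain ⟨C, h⟩ := hPf.exists_coefficientBounds hbd hf
  choose Y hYm hY using fun n => exists_scaledError_process h hγ hX w n (j n)
  obtain ⟨K, hK0, N, hN, hK⟩ : ∃ K : ℝ, 0 < K ∧ ∃ N : ℕ, 0 < N ∧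
      ∀ n ≥ N, (2 : ℝ) ^ (j n) * (j n : ℝ) ≤ K * n := by
    obtain ⟨K, hK0, hK⟩ := hj_var.exists_pos
    obtain ⟨N, hN⟩ := eventually_atTop.1 hK.bound
    refine ⟨K, hK0, max N 1, by positivity, fun n hn => ?_⟩
    have hn0 : (0 : ℝ) < n := by exact_mod_cast (le_max_right N 1).trans hn
    have h1 := hN n ((le_max_left N 1).trans hn)
    rw [norm_one, mul_one] at h1
    exact (div_le_iff₀ hn0).1 ((Real.le_norm_self _).trans h1)
  set law : ℕ → ProbabilityMeasure (M₀ w) := fun n =>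
    ⟨μ.map (Y n), Measure.isProbabilityMeasure_map (hYm n)⟩ with hlaw
  -- by Prokhorov's theorem the laws eventually stay in a compact set
  have htight := isTightMeasureSet_scaledError hw h hγ hX hindep hj hj_bias hN hK0 hK hYm hY
  have hcompact : IsCompact (closure (law '' Ici N)) := by
    refine isCompact_closure_of_isTightMeasureSet (htight.subset ?_)
    rintro _ ⟨_, ⟨n, hn, rfl⟩, rfl⟩
    exact ⟨n, hn, rfl⟩
  have hev : ∀ᶠ n in atTop, law n ∈ closure (law '' Ici N) := by
    filter_upwards [eventually_ge_atTop N] with n hn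
    exact subset_closure (mem_image_of_mem _ hn)
  -- pushing forward by a linear combination of entries is continuous, so that the central limit
  -- theorem identifies the image of every cluster point
  have hcluster : ∀ ν : ProbabilityMeasure (M₀ w), MapClusterPt ν atTop law →
      IsBridgeLaw P ψ (ν : Measure (M₀ w)) := by
    intro ν hν T _ t c
    have hF : Continuous fun x : M₀ w => ∑ a, c a * M₀.entry x (t a) := by fun_prop
    have hcomp : ∀ n, (fun x : M₀ w => ∑ a, c a * M₀.entry x (t a)) ∘ Y n
        = fun ω => ∑ a, c a * scaledError P ψ X n (j n) ω (t a) := fun n => by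
      funext ω
      simp only [Function.comp_apply, hY]
    have hm : ∀ n, AEMeasurable (fun ω => ∑ a, c a * scaledError P ψ X n (j n) ω (t a)) μ :=
      fun n => by
        rw [← hcomp]
        exact hF.measurable.comp_aemeasurable (hYm n)
    have h1 := tendsto_map_combination h hX hindep (tendsto_resolution_atTop hγ hj hj_bias) t c hm
    have h2 := hν.continuousAt_comp (ProbabilityMeasure.continuous_map hF).continuousAt
    have h3 : (fun ν => ProbabilityMeasure.map ν hF.aemeasurable) ∘ law
        = fun n => ⟨μ.map (fun ω => ∑ a, c a * scaledError P ψ X n (j n) ω (t a)),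
          Measure.isProbabilityMeasure_map (hm n)⟩ := by
      funext n
      refine Subtype.ext ?_
      change (μ.map (Y n)).map _ = _
      rw [AEMeasurable.map_map_of_aemeasurable hF.aemeasurable (hYm n), hcomp]
    rw [h3] at h2
    have h4 := @eq_of_nhds_neBot (ProbabilityMeasure ℝ) _ _ _ _ (ClusterPt.mono h2 h1)
    exact congrArg Subtype.val h4
  obtain ⟨G, -, hG⟩ : ∃ G : ProbabilityMeasure (M₀ w), G ∈ closure (law '' Ici N) ∧
      MapClusterPt G atTop law :=
    hcompact (le_principal_iff.2 hev)
  have hlim : Tendsto law atTop (𝓝 G) := by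
    refine hcompact.tendsto_nhds_of_unique_mapClusterPt hev fun ν _ hν => ?_
    have huniq : (ν : Measure (M₀ w)) = G := (hcluster ν hν).unique (hcluster G hG)
    exact Subtype.ext huniq
  refine ⟨Y, G, inferInstance, hY,
    (hcluster G hG).isWhiteBridge fun i => h.memLp i 2, hYm, aemeasurable_id, ?_⟩
  have hid : (⟨(G : Measure (M₀ w)).map id, Measure.isProbabilityMeasure_map aemeasurable_id⟩ :
      ProbabilityMeasure (M₀ w)) = G := Subtype.ext Measure.map_id
  rw [hid]
  exact hlim
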